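/- A layered automaton over a finite alphabet $\Sigma$ consists of finite deterministic (partial) transition systems $\mathcal T_1,\dots,\mathcal T_d$ over $\Sigma$ ($d\ge 1$) with pairwise disjoint state sets $Q_1,\dots,Q_d$, and of morphisms $\mu_x:\mathcal T_{x+1}\to\mathcal T_x$ ($1\le x<d$), where $\mathcal T_1$ is complete, has an initial state $q_{\mathrm{init}}$, and all its states are reachable from $q_{\mathrm{init}}$. For $q\in Q_y$ and $x\le y$ let $\hat\mu_x(q)\in Q_x$ be the image of $q$ under $\mu_x\circ\dots\circ\mu_{y-1}$ (so $\hat\mu_y(q)=q$). A leaf is a state in the image of no $\mu_x$. The semantics $[\![\mathcal A]\!]$ of a layered automaton $\mathcal A$ is the following alternating parity automaton. Its states are the leaves, and its initial state is any leaf $q$ with $\hat\mu_1(q)=q_{\mathrm{init}}$. For a leaf $q$ and a letter $a$, let $x$ be the biggest layer such that the $a$-transition from $\hat\mu_x(q)$ is defined in $\mathcal T_x$, leading to $p$ say; there is an $a$-transition of priority $x$ from $q$ to each leaf $q'$ with $\hat\mu_x(q')=p$. On an infinite word $w$, Eve and Adam build a run of $[\![\mathcal A]\!]$ over $w$; Eve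 chooses the transition when the priority is odd and Adam when it is even, and Eve wins if the least priority that occurs infinitely often is even. The language $L(\mathcal A)\subseteq\Sigma^\omega$ is the set of words for which Eve has a winning strategy. A word $w\in\Sigma^\omega$ is strongly safe from $p\in Q_x$ if the run over $w$ from $p$ in $\mathcal T_x$ is defined and there are no decomposition $w=uw'$ and state $p'\in Q_{x+1}$ (where $Q_{d+1}=\emptyset$) such that $u$ leads from $p$ to $\mu_x(p')$ in $\mathcal T_x$ and the run over $w'$ from $p'$ in $\mathcal T_{x+1}$ is defined; then $w$ is strongly accepted by $p$ if $x$ is even and strongly rejected by $p$ if $x$ is odd. $\mathcal A$ is consistent if there are no states $p,p'$ with $\hat\mu_1(p)=\hat\mu_1(p')$ and no word that is strongly accepted by $p$ and strongly rejected by $p'$. **Proposition.** There is an algorithm (Turing machine) that, given two consistent layered automata $\mathcal A$ and $\mathcal A'$ over a common finite alphabet (all given explicitly by their transition tables), decides in time polynomial in the size of the input whether $L(\mathcal A)\subseteq L(\mathcal A')$. The answer is correct for every choice of the initial leaves of $[\![\mathcal A]\!]$ and $[\![\mathcal A']\!]$. -/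

import Mathlib

/-! ## Alternating parity automata that are simple by priorities -/

/-- The min-parity condition: the least priority occurring infinitely often is even. -/
def MinParity (c : ℕ → ℕ) : Prop :=
  ∃ x, Even x ∧ (∃ᶠ i in Filter.atTop, c i = x) ∧ (∀ᶠ i in Filter.atTop, x ≤ c i)

/-- A simple by priorities alternating parity automaton: a complete transition system with an
initial state, in which all transitions leaving `q` with the letter `a` carry the same priority
`prio q a`. -/
structure SimpleAutomaton (Q S : Type*) where
  init : Q
  prio : Q → S → ℕ
  trans : Q → S → Q → Prop
  complete : ∀ q a, ∃ q', trans q a q'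

namespace SimpleAutomaton

variable {Q S : Type*}

/-- A run over the infinite word `w` from the initial state. -/
def IsRun (B : SimpleAutomaton Q S) (w : ℕ → S) (r : ℕ → Q) : Prop :=
  r 0 = B.init ∧ ∀ i, B.trans (r i) (w i) (r (i + 1))

/-- A strategy of Eve in the acceptance game over `w`. In round `h.length`, when the states
visited before are `h` and the current state is `q`, it proposes the next state `σ h q`; the
proposal must be a legal move whenever Eve is to move, i.e. when the priority is odd. -/
def IsEveStrategy (B : SimpleAutomaton Q S) (w : ℕ → S) (σ : List Q → Q → Q) : Prop :=
  ∀ (h : List Q) (q : Q), Odd (B.prio q (w h.length)) →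
    B.trans q (w h.length) (σ h q)

/-- The run `r` follows Eve's strategy `σ`: at odd priorities the next state is the one that `σ`
proposes (at even priorities Adam chooses). -/
def Follows (B : SimpleAutomaton Q S) (w : ℕ → S) (σ : List Q → Q → Q) (r : ℕ → Q) : Prop :=
  ∀ i, Odd (B.prio (r i) (w i)) → r (i + 1) = σ ((List.range i).map r) (r i)

/-- Eve has a winning strategy in the acceptance game of `B` over `w`. -/
def Accepts (B : SimpleAutomaton Q S) (w : ℕ → S) : Prop :=
  ∃ σ : List Q → Q → Q, B.IsEveStrategy w σ ∧
    ∀ r : ℕ → Q, B.IsRun w r → B.Follows w σ r → MinParity (fun i => B.prio (r i) (w i))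

/-- The language of infinite words recognised by `B`. -/
def language (B : SimpleAutomaton Q S) : Set (ℕ → S) :=
  {w | B.Accepts w}

end SimpleAutomaton

/-! ## Layered automata -/

/-- A layered automaton over the alphabet `S`: deterministic transition systems `T₁, …, T_d`
(`d = depth`) with morphisms `μ_x : T_{x+1} → T_x`. The type `Q` is the disjoint union of the state
sets; the states of `T_x` are those with `layer q = x`. The partial transition functions of all
layers are combined into `step`, and all the maps `μ_x` into `parent` (`none` exactly on layer
`1`). -/
structure LayeredAutomaton (Q S : Type*) where
  depth : ℕ
  layer : Q → ℕ
  one_le_layer : ∀ q, 1 ≤ layer q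
  layer_le_depth : ∀ q, layer q ≤ depth
  step : Q → S → Option Q
  layer_step : ∀ q a q', step q a = some q' → layer q' = layer q
  parent : Q → Option Q
  parent_eq_none_iff : ∀ q, parent q = none ↔ layer q = 1
  layer_parent : ∀ q p, parent q = some p → layer q = layer p + 1
  /-- each `μ_x` is a morphism of transition systems -/
  parent_step : ∀ q a q' p p', step q a = some q' → parent q = some p → parent q' = some p' →
    step p a = some p'
  /-- `T₁` is complete -/
  step_complete : ∀ q a, layer q = 1 → ∃ q', step q a = some q'
  init : Q
  layer_init : layer init = 1
  /-- every state of `T₁` is reachable from the initial state -/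
  reachable : ∀ q, layer q = 1 →
    Relation.ReflTransGen (fun p p' => ∃ a, step p a = some p') init q

namespace LayeredAutomaton

variable {Q S : Type*} (A : LayeredAutomaton Q S)

/-- The ancestor of `q` on layer `x` (for `1 ≤ x ≤ layer q`; otherwise `none`). -/
def ancestor (x : ℕ) (q : Q) : Option Q :=
  if x ≤ A.layer q then (fun o : Option Q => o.bind A.parent)^[A.layer q - x] (some q) else none

/-- The `a`-successor on layer `x` of the ancestor of `q` on layer `x`, if defined. -/
def stepAt (x : ℕ) (q : Q) (a : S) : Option Q :=
  (A.ancestor x q).bind fun p => A.step p a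

/-- The biggest layer `x` on which the `a`-transition from the ancestor of `q` is defined. -/
def actionLayer (q : Q) (a : S) : ℕ :=
  Nat.findGreatest (fun x => (A.stepAt x q a).isSome = true) (A.layer q)

/-- A leaf state is a state that is not in the image of any of the morphisms. -/
def IsLeaf (q : Q) : Prop := ∀ c, A.parent c ≠ some q

/-- The type of leaf states. -/
abbrev Leaf : Type _ := {q : Q // A.IsLeaf q}

/-- The leaf states below the initial state of the first layer. -/
abbrev InitialLeaf : Type _ := {q : A.Leaf // A.ancestor 1 q.1 = some A.init}

theorem ancestor_self (q : Q) : A.ancestor (A.layer q) q = some q := by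
  simp [ancestor]

theorem ancestor_of_parent {q p : Q} (h : A.parent q = some p) {x : ℕ} (hx : x ≤ A.layer p) :
    A.ancestor x q = A.ancestor x p := by
  have hl := A.layer_parent q p h
  have h1 : A.layer q - x = (A.layer p - x) + 1 := by omega
  have h2 : x ≤ A.layer q := by omega
  simp only [ancestor, h2, hx, if_true, h1, Function.iterate_succ_apply, Option.bind_some, h]

theorem exists_leaf_below (p : Q) :
    ∃ q : A.Leaf, ∀ x ≤ A.layer p, A.ancestor x q.1 = A.ancestor x p := by
  induction hn : A.depth - A.layer p generalizing p with
  | zero =>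
    refine ⟨⟨p, fun c hc => ?_⟩, fun _ _ => rfl⟩
    have h1 := A.layer_parent c p hc
    have h2 := A.layer_le_depth c
    omega
  | succ n ih =>
    by_cases hp : A.IsLeaf p
    · exact ⟨⟨p, hp⟩, fun _ _ => rfl⟩
    · simp only [IsLeaf, not_forall, not_not] at hp
      obtain ⟨c, hc⟩ := hp
      have h1 := A.layer_parent c p hc
      obtain ⟨q, hq⟩ := ih c (by omega)
      exact ⟨q, fun x hx => (hq x (by omega)).trans (A.ancestor_of_parent hc hx)⟩

theorem exists_ancestor_one (q : Q) : ∃ r, A.ancestor 1 q = some r ∧ A.layer r = 1 := by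
  induction hn : A.layer q generalizing q with
  | zero => have := A.one_le_layer q; omega
  | succ n ih =>
    cases h : A.parent q with
    | none =>
      have h1 := (A.parent_eq_none_iff q).1 h
      exact ⟨q, by rw [← h1, A.ancestor_self], h1⟩
    | some p =>
      have h1 := A.layer_parent q p h
      obtain ⟨r, hr, hl⟩ := ih p (by omega)
      exact ⟨r, by rw [A.ancestor_of_parent h (A.one_le_layer p), hr], hl⟩

theorem ancestor_layer {x : ℕ} {q p : Q} (h : A.ancestor x q = some p) : A.layer p = x := by
  induction hn : A.layer q generalizing q with
  | zero => have := A.one_le_layer q; omega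
  | succ n ih =>
    by_cases hx : x ≤ A.layer q
    · rcases Nat.eq_or_lt_of_le hx with hx' | hx'
      · rw [hx', A.ancestor_self] at h
        rw [hx', ← Option.some.inj h]
      · cases hp : A.parent q with
        | none =>
          have h1 : A.layer q - x = (A.layer q - x - 1) + 1 := by omega
          have h2 : ∀ m, (fun o : Option Q => o.bind A.parent)^[m] none = none := fun m =>
            Function.iterate_fixed rfl m
          simp only [ancestor, hx, if_true] at h
          rw [h1, Function.iterate_succ_apply] at h
          simp [hp, h2] at h
        | some r =>
          have h1 := A.layer_parent q r hp
          rw [A.ancestor_of_parent hp (by omega)] at h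
          exact ih h (by omega)
    · simp [ancestor, hx] at h

theorem exists_initialLeaf : Nonempty A.InitialLeaf := by
  obtain ⟨q, hq⟩ := A.exists_leaf_below A.init
  refine ⟨⟨q, ?_⟩⟩
  rw [hq 1 (A.one_le_layer _)]
  exact A.layer_init ▸ A.ancestor_self A.init

theorem sem_complete (q : A.Leaf) (a : S) : ∃ q' : A.Leaf, ∃ p,
    A.stepAt (A.actionLayer q.1 a) q.1 a = some p ∧
      A.ancestor (A.actionLayer q.1 a) q'.1 = some p := by
  obtain ⟨r, hr, hr1⟩ := A.exists_ancestor_one q.1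
  obtain ⟨r', hr'⟩ := A.step_complete r a hr1
  have h1 : (A.stepAt 1 q.1 a).isSome = true := by simp [stepAt, hr, hr']
  have h2 : (A.stepAt (A.actionLayer q.1 a) q.1 a).isSome = true :=
    Nat.findGreatest_spec (P := fun x => (A.stepAt x q.1 a).isSome = true)
      (A.one_le_layer q.1) h1
  obtain ⟨p, hp⟩ := Option.isSome_iff_exists.1 h2
  have hp' := hp
  rw [stepAt, Option.bind_eq_some_iff] at hp'
  obtain ⟨s, hs, hsp⟩ := hp'
  have hl : A.layer p = A.actionLayer q.1 a := by
    rw [A.layer_step s a p hsp, A.ancestor_layer hs]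
  obtain ⟨q', hq'⟩ := A.exists_leaf_below p
  exact ⟨q', p, hp, by rw [hq' _ hl.ge, ← hl, A.ancestor_self]⟩

/-- The semantics automaton of `A`, with a chosen initial leaf state. Its states are the leaf
states; for `x = actionLayer q a` there is a transition of priority `x` from `q` to each leaf `q'`
such that the `x`-th layer has an `a`-transition between the ancestors of `q` and `q'`. -/
def sem (q₀ : A.InitialLeaf) : SimpleAutomaton A.Leaf S where
  init := q₀.1
  prio q a := A.actionLayer q.1 a
  trans q a q' := ∃ p, A.stepAt (A.actionLayer q.1 a) q.1 a = some p ∧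
    A.ancestor (A.actionLayer q.1 a) q'.1 = some p
  complete := A.sem_complete

/-! ### Strong acceptance and consistency -/

/-- The state reached from `q`, within the layer of `q`, after the first `n` letters of `w`. -/
def run (q : Q) (w : ℕ → S) : ℕ → Option Q
  | 0 => some q
  | n + 1 => (run q w n).bind fun p => A.step p (w n)

/-- The infinite word `w` is in the safe language of `q` with respect to the layer of `q`. -/
def Safe (q : Q) (w : ℕ → S) : Prop := ∀ n, (A.run q w n).isSome = true

/-- `w` is safe from `p`, on layer `x = layer p`, and for no decomposition `w = u w'` is there a
state `p'` of layer `x + 1` such that `u` leads on layer `x` from `p` to the parent of `p'` and `w'`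
is safe from `p'`. -/
def StronglySafe (p : Q) (w : ℕ → S) : Prop :=
  A.Safe p w ∧ ¬ ∃ (n : ℕ) (r p' : Q), A.run p w n = some r ∧ A.parent p' = some r ∧
    A.Safe p' (fun i => w (n + i))

/-- `w` is strongly accepted by `p`. -/
def StronglyAccepts (p : Q) (w : ℕ → S) : Prop := Even (A.layer p) ∧ A.StronglySafe p w

/-- `w` is strongly rejected by `p`. -/
def StronglyRejects (p : Q) (w : ℕ → S) : Prop := Odd (A.layer p) ∧ A.StronglySafe p w

/-- No infinite word is strongly accepted and strongly rejected by two states with the same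
ancestor on the first layer. -/
def Consistent : Prop :=
  ¬ ∃ (p p' : Q) (w : ℕ → S), A.ancestor 1 p = A.ancestor 1 p' ∧
    A.StronglyAccepts p w ∧ A.StronglyRejects p' w

end LayeredAutomaton

/-! ## The inclusion problem as a problem on bit strings -/

/-- Unary code of a number, terminated by `false`. -/
def unaryCode (m : ℕ) : List Bool := List.replicate m true ++ [false]

/-- Code of a possibly undefined state: `0` if undefined, and `i + 1` for the state `i`. -/
def optionCode {n : ℕ} : Option (Fin n) → List Bool
  | none => unaryCode 0
  | some i => unaryCode (i.val + 1)

/-- The explicit table of a layered automaton with states `0, …, n - 1` and letters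
`0, …, k - 1`: the number of states, the number of layers, the initial state, and for each state
its layer, its parent and its `k` successors. As the `n * k` table entries (and `n ≥ 1` states) are
listed explicitly, the length is polynomially related to `n + k + d`, where `d` is the number of
layers. Writing state names in binary would change the length only polynomially. -/
def LayeredAutomaton.code {n k : ℕ} (A : LayeredAutomaton (Fin n) (Fin k)) : List Bool :=
  unaryCode n ++ unaryCode A.depth ++ unaryCode A.init.val ++
    (List.finRange n).flatMap fun q =>
      unaryCode (A.layer q) ++ optionCode (A.parent q) ++
        (List.finRange k).flatMap fun a => optionCode (A.step q a)

/-- An input of the inclusion problem: two finite consistent layered automata over a common finite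
alphabet (which is part of the input). -/
structure InclusionInstance where
  k : ℕ
  n : ℕ
  n' : ℕ
  A : LayeredAutomaton (Fin n) (Fin k)
  A' : LayeredAutomaton (Fin n') (Fin k)
  consistent : A.Consistent
  consistent' : A'.Consistent

/-- The bit string by which an input is presented to a machine. -/
def InclusionInstance.code (I : InclusionInstance) : List Bool :=
  unaryCode I.k ++ I.A.code ++ I.A'.code

/-! The key is a description of the language that does not mention games. In the game, the layers up
to the current priority move deterministically, and the choice of a leaf only matters above it. Call
a move good if, whenever the rest of the word is safe from some child of the state reached on the
layer of the priority, the move goes below such a child. Let `y` be the least priority seen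
infinitely often in a play where all moves of priority `y` are good. Then some suffix is strongly
safe from a state of layer `y` (`eventuallyStronglySafe_of_goodMove`): a child that stayed safe
would be picked up at the next visit of priority `y`, after which the priority would stay above `y`.

Only the owner of the priority `y` has to play well here. Good moves of Adam against a winning
strategy of Eve yield a strongly safe suffix on an even layer. Conversely, if such a suffix exists,
good moves of Eve win, because an odd `y` would yield one on an odd layer, against consistency. So
`w` is accepted iff it is eventually strongly accepted (`mem_language_iff`), and rejected iff it is
eventually strongly rejected (`notMem_language_iff`).

Inclusion therefore fails iff some word is eventually strongly accepted in the first automaton and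
eventually strongly rejected in the second. By pigeonhole such a word gives a pair `(p, p')` with,
for every single child of `p` or `p'`, a common cycle on `(p, p')` that kills this child. Conversely
such cycles can be concatenated into one that kills all children, because a cycle on `p` maps every
child of `p` to a child of `p` or kills it; repeating it gives a counterexample
(`language_subset_iff`). As the children are treated one at a time, it suffices to test reachability
in the product of the two automata with one additional token, a graph of polynomial size.

To obtain a Turing machine, structured programs on stacks are compiled to `FinTM2`. The class
`PolyTime` of functions computed by such programs is closed under composition, branching and bounded
iteration with polynomially bounded values, hence under bounded quantifiers and graph reachability.
The criterion is then written as a predicate on the input string. -/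

/-! ### Structured programs for machines with several stacks -/

/-- Structured programs on stacks of bits. -/
inductive StackProgram (K : Type) : Type
  | push (k : K) (b : Bool)
  | pop (k : K)
  | seq (p q : StackProgram K)
  /-- branches on the top of a stack: empty, `false` or `true` -/
  | caseTop (k : K) (p q r : StackProgram K)
  /-- repeats the body as long as the stack `k` is nonempty -/
  | loop (k : K) (p : StackProgram K)

namespace StackProgram

open Turing Function

variable {K : Type}

/-- Big-step semantics of programs, with the running time. -/
inductive Run [DecidableEq K] :
    StackProgram K → (K → List Bool) → (K → List Bool) → ℕ → Prop
  | push (k b s) : Run (push k b) s (update s k (b :: s k)) 1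
  | pop (k s) : Run (pop k) s (update s k (s k).tail) 1
  | seq {p q s s' s'' t t'} : Run p s s' t → Run q s' s'' t' → Run (seq p q) s s'' (t + t')
  | case_nil {k p q r s s' t} : s k = [] → Run p s s' t → Run (caseTop k p q r) s s' (t + 1)
  | case_false {k p q r s s' l t} :
      s k = false :: l → Run q s s' t → Run (caseTop k p q r) s s' (t + 1)
  | case_true {k p q r s s' l t} :
      s k = true :: l → Run r s s' t → Run (caseTop k p q r) s s' (t + 1)
  | loop_nil {k p s} : s k = [] → Run (loop k p) s s 1
  | loop_cons {k p s s' s'' b l t t'} : s k = b :: l → Run p s s' t →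
      Run (loop k p) s' s'' t' → Run (loop k p) s s'' (1 + t + t')

/-- The labels of the machine code of a program. -/
def Label : StackProgram K → Type
  | push _ _ => Unit
  | pop _ => Unit
  | seq p q => Label p ⊕ Label q
  | caseTop _ p q r => Option (Label p ⊕ Label q ⊕ Label r)
  | loop _ p => Option (Label p)

theorem finite_label : (p : StackProgram K) → Finite (Label p)
  | push _ _ => inferInstanceAs (Finite Unit)
  | pop _ => inferInstanceAs (Finite Unit)
  | seq p q =>
    have := finite_label p
    have := finite_label q
    inferInstanceAs (Finite (Label p ⊕ Label q))
  | caseTop _ p q r =>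
    have := finite_label p
    have := finite_label q
    have := finite_label r
    inferInstanceAs (Finite (Option (Label p ⊕ Label q ⊕ Label r)))
  | loop _ p =>
    have := finite_label p
    inferInstanceAs (Finite (Option (Label p)))

/-- The label at which the execution of a program starts. -/
def entry : (p : StackProgram K) → Label p
  | push _ _ => ()
  | pop _ => ()
  | seq p _ => Sum.inl (entry p)
  | caseTop _ _ _ _ => none
  | loop _ _ => none

/-- The machine code of a program, where the labels are embedded into `Λ` by `f`, and `x` is the
label to which control passes at the end. -/
def code {Λ : Type} : (p : StackProgram K) → (f : Label p → Λ) → (x : Λ) → Label p →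
    TM2.Stmt (fun _ : K => Bool) Λ (Option Bool)
  | push k b, _, x, _ => .push k (fun _ => b) (.goto fun _ => x)
  | pop k, _, x, _ => .pop k (fun v _ => v) (.goto fun _ => x)
  | seq p q, f, _, .inl l => code p (f ∘ Sum.inl) (f (Sum.inr (entry q))) l
  | seq _ q, f, x, .inr l => code q (f ∘ Sum.inr) x l
  | caseTop k p q r, f, _, none =>
    -- The register holds the inspected symbol only until the jump. Resetting it to `none` means
    -- that every label is entered with the same register, so that configurations at labels are
    -- determined by the stacks.
    .peek k (fun _ o => o) <| .branch (fun v => v.isNone)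
      (.load (fun _ => none) <| .goto fun _ => f (some (.inl (entry p))))
      (.branch (fun v => v == some true)
        (.load (fun _ => none) <| .goto fun _ => f (some (.inr (.inr (entry r)))))
        (.load (fun _ => none) <| .goto fun _ => f (some (.inr (.inl (entry q))))))
  | caseTop _ p _ _, f, x, some (.inl l) => code p (fun l => f (some (.inl l))) x l
  | caseTop _ _ q _, f, x, some (.inr (.inl l)) => code q (fun l => f (some (.inr (.inl l)))) x l
  | caseTop _ _ _ r, f, x, some (.inr (.inr l)) => code r (fun l => f (some (.inr (.inr l)))) x l
  | loop k p, f, x, none =>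
    .peek k (fun _ o => o) <| .branch (fun v => v.isNone)
      (.load (fun _ => none) <| .goto fun _ => x)
      (.load (fun _ => none) <| .goto fun _ => f (some (entry p)))
  | loop _ p, f, _, some l => code p (f ∘ some) (f none) l

theorem iterate_bind_add {α : Type*} (g : α → Option α) {a b c : α} {m n : ℕ}
    (h : (flip Option.bind g)^[m] (some a) = some b)
    (h' : (flip Option.bind g)^[n] (some b) = some c) :
    (flip Option.bind g)^[m + n] (some a) = some c := by
  rw [add_comm, iterate_add_apply, h, h']

/-- The time of the big-step semantics counts exactly the machine steps. The embedding of the labels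
and the exit label are arbitrary, because in the induction a subprogram sits inside larger code and
exits to its successor or to the head of its loop. -/
theorem Run.iterate_step [DecidableEq K] {Λ : Type}
    {M : Λ → TM2.Stmt (fun _ : K => Bool) Λ (Option Bool)}
    {p : StackProgram K} {s s' : K → List Bool} {t : ℕ} (h : Run p s s' t) :
    ∀ {f : Label p → Λ} {x : Λ}, (∀ l, M (f l) = code p f x l) →
      (flip Option.bind (TM2.step M))^[t] (some ⟨some (f (entry p)), none, s⟩) =
        some ⟨some x, none, s'⟩ := by
  induction h with
  | push k b s =>
    intro f x hM
    simp [flip, TM2.step, hM, code]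
  | pop k s =>
    intro f x hM
    simp [flip, TM2.step, hM, code]
  | @seq p q s s' s'' t t' _ _ ih ih' =>
    intro f x hM
    exact iterate_bind_add _ (ih (f := f ∘ Sum.inl) fun l => hM (.inl l))
      (ih' (f := f ∘ Sum.inr) fun l => hM (.inr l))
  | @case_nil k p q r s s' t hk _ ih =>
    intro f x hM
    rw [add_comm]
    refine iterate_bind_add _ (b := ⟨some (f (some (.inl (entry p)))), none, s⟩) ?_
      (ih (f := fun l => f (some (.inl l))) fun l => hM (some (.inl l)))
    have h0 : M (f none) = _ := hM none
    simp [flip, TM2.step, entry, h0, code, hk]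
  | @case_false k p q r s s' l t hk _ ih =>
    intro f x hM
    rw [add_comm]
    refine iterate_bind_add _ (b := ⟨some (f (some (.inr (.inl (entry q))))), none, s⟩) ?_
      (ih (f := fun l => f (some (.inr (.inl l)))) fun l => hM (some (.inr (.inl l))))
    have h0 : M (f none) = _ := hM none
    simp [flip, TM2.step, entry, h0, code, hk]
  | @case_true k p q r s s' l t hk _ ih =>
    intro f x hM
    rw [add_comm]
    refine iterate_bind_add _ (b := ⟨some (f (some (.inr (.inr (entry r))))), none, s⟩) ?_
      (ih (f := fun l => f (some (.inr (.inr l)))) fun l => hM (some (.inr (.inr l))))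
    have h0 : M (f none) = _ := hM none
    simp [flip, TM2.step, entry, h0, code, hk]
  | @loop_nil k p s hk =>
    intro f x hM
    have h0 : M (f none) = _ := hM none
    simp [flip, TM2.step, entry, h0, code, hk]
  | @loop_cons k p s s' s'' b l t t' hk _ _ ih ih' =>
    intro f x hM
    refine iterate_bind_add _ (iterate_bind_add _ (b := ⟨some (f (some (entry p))), none, s⟩) ?_
      (ih (f := f ∘ some) fun l => hM (some l))) (ih' hM)
    have h0 : M (f none) = _ := hM none
    simp [flip, TM2.step, entry, h0, code, hk]

/-- The machine that executes a program on the input stack `k₀` and output stack `k₁`. -/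
noncomputable def machine [DecidableEq K] [Fintype K] (p : StackProgram K) (k₀ k₁ : K) : FinTM2 where
  K := K
  k₀ := k₀
  k₁ := k₁
  Γ _ := Bool
  Λ := Option (Label p)
  main := some (entry p)
  ΛFin := haveI := finite_label p; Fintype.ofFinite _
  σ := Option Bool
  initialState := none
  Γk₀Fin := inferInstanceAs (Fintype Bool)
  m l := match l with
    | none => .halt
    | some l => code p some none l

theorem Run.outputsInTime [DecidableEq K] [Fintype K] {p : StackProgram K} {k₀ k₁ : K}
    {l l' : List Bool} {t T : ℕ}
    (h : Run p (update (fun _ => []) k₀ l) (update (fun _ => []) k₁ l') t) (hT : t + 1 ≤ T) :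
    Nonempty (TM2OutputsInTime (machine p k₀ k₁) l (some l') T) := by
  -- The additional step executes `halt` at the exit label `none`.
  refine ⟨⟨⟨t + 1, ?_⟩, hT⟩⟩
  have h1 : initList (machine p k₀ k₁) l =
      ⟨some (some (entry p)), none, update (fun _ => []) k₀ l⟩ := by
    simp only [initList, machine]
    congr 1
    funext k
    by_cases hk : k = k₀
    · subst hk
      have h0 : update (fun _ : K => ([] : List Bool)) k l k = l := update_self ..
      exact (dif_pos rfl).trans h0.symm
    · have h0 : update (fun _ : K => ([] : List Bool)) k₀ l k = [] := update_of_ne hk ..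
      exact (dif_neg hk).trans h0.symm
  have h2 : haltList (machine p k₀ k₁) l' = ⟨none, none, update (fun _ => []) k₁ l'⟩ := by
    simp only [haltList, machine]
    congr 1
    funext k
    by_cases hk : k = k₁
    · subst hk
      have h0 : update (fun _ : K => ([] : List Bool)) k l' k = l' := update_self ..
      exact (dif_pos rfl).trans h0.symm
    · have h0 : update (fun _ : K => ([] : List Bool)) k₁ l' k = [] := update_of_ne hk ..
      exact (dif_neg hk).trans h0.symm
  have h3 : Option.map (haltList (machine p k₀ k₁)) (some l') =
      some ⟨none, none, update (fun _ => []) k₁ l'⟩ := congrArg some h2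
  rw [h1, h3]
  refine iterate_bind_add _
    (h.iterate_step (M := (machine p k₀ k₁).m) (f := some) (x := none) fun l => rfl) ?_
  rfl

end StackProgram

/-! ### Running times of elementary stack programs -/

namespace StackProgram

open Function

variable {K : Type} [DecidableEq K]

/-- The program `p` transforms `s` into `s'` in time at most `T`. -/
def RunIn (p : StackProgram K) (s s' : K → List Bool) (T : ℕ) : Prop :=
  ∃ t ≤ T, Run p s s' t

theorem RunIn.mono {p : StackProgram K} {s s' : K → List Bool} {T T' : ℕ} (h : RunIn p s s' T)
    (hT : T ≤ T') : RunIn p s s' T' :=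
  let ⟨t, ht, hr⟩ := h
  ⟨t, ht.trans hT, hr⟩

theorem RunIn.seq {p q : StackProgram K} {s s' s'' : K → List Bool} {T T' : ℕ}
    (h : RunIn p s s' T) (h' : RunIn q s' s'' T') : RunIn (seq p q) s s'' (T + T') :=
  let ⟨t, ht, hr⟩ := h
  let ⟨t', ht', hr'⟩ := h'
  ⟨t + t', add_le_add ht ht', hr.seq hr'⟩

theorem runIn_push (k : K) (b : Bool) (s : K → List Bool) :
    RunIn (push k b) s (update s k (b :: s k)) 1 :=
  ⟨1, le_rfl, .push ..⟩

theorem runIn_pop (k : K) (s : K → List Bool) :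
    RunIn (pop k) s (update s k (s k).tail) 1 :=
  ⟨1, le_rfl, .pop ..⟩

/-- The sequence `S` is the loop invariant: it prescribes all stacks after each round. Every round
pays one step for the test, and the last test pays one more. -/
theorem runIn_loop {k : K} {p : StackProgram K} {T : ℕ} (n : ℕ) (S : ℕ → K → List Bool)
    (hb : ∀ i < n, S i k ≠ [] ∧ RunIn p (S i) (S (i + 1)) T) (he : S n k = []) :
    RunIn (loop k p) (S 0) (S n) (n * (T + 1) + 1) := by
  induction n generalizing S with
  | zero => exact ⟨1, by simp, .loop_nil he⟩
  | succ n ih =>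
    obtain ⟨h0, t, ht, hr⟩ := hb 0 (Nat.succ_pos n)
    obtain ⟨t', ht', hr'⟩ := ih (fun i => S (i + 1)) (fun i hi => hb (i + 1) (by omega)) he
    obtain ⟨b, l, hl⟩ := List.exists_cons_of_ne_nil h0
    refine ⟨1 + t + t', ?_, .loop_cons hl hr hr'⟩
    rw [add_mul]
    omega

/-- Empties a stack. -/
def clear (k : K) : StackProgram K := loop k (pop k)

theorem runIn_clear (k : K) (s : K → List Bool) {B : ℕ} (hB : (s k).length ≤ B) :
    RunIn (clear k) s (update s k []) (2 * B + 1) := by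
  have h := runIn_loop (k := k) (p := pop k) (T := 1) (s k).length
    (fun i => update s k ((s k).drop i)) (fun i hi => ⟨by simpa using hi, ?_⟩) (by simp)
  · simp only [List.drop_zero, update_eq_self, List.drop_length] at h
    exact h.mono (by omega)
  · have := runIn_pop k (update s k ((s k).drop i))
    simpa using this

/-- Branching on the top of a nonempty stack. -/
theorem RunIn.caseTop_cons {a : K} {f : Bool → StackProgram K} {p : StackProgram K}
    {s s' : K → List Bool} {b : Bool} {l : List Bool} {T : ℕ}
    (hs : s a = b :: l) (h : RunIn (f b) s s' T) :
    RunIn (caseTop a p (f false) (f true)) s s' (T + 1) := by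
  obtain ⟨t, ht, hr⟩ := h
  refine ⟨t + 1, by omega, ?_⟩
  cases b
  · exact .case_false hs hr
  · exact .case_true hs hr

/-- Moves the contents of the stack `a` to the stack `b`, in reversed order. -/
def move (a b : K) : StackProgram K :=
  loop a (caseTop a (pop a) (seq (pop a) (push b false)) (seq (pop a) (push b true)))

theorem runIn_move {a b : K} (hab : a ≠ b) (s : K → List Bool) {B : ℕ} (hB : (s a).length ≤ B) :
    RunIn (move a b) s (update (update s a []) b ((s a).reverse ++ s b)) (4 * B + 1) := by
  have h := runIn_loop (k := a)
    (p := caseTop a (pop a) (seq (pop a) (push b false)) (seq (pop a) (push b true)))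
    (T := 3) (s a).length
    (fun i => update (update s a ((s a).drop i)) b (((s a).take i).reverse ++ s b))
    (fun i hi => ⟨by simpa [hab] using hi, ?_⟩) (by simp [hab])
  · simp only [List.drop_zero, update_eq_self, List.drop_length, List.take_zero, List.take_length,
      List.reverse_nil, List.nil_append] at h
    exact h.mono (by omega)
  · refine RunIn.caseTop_cons (f := fun c => seq (pop a) (push b c)) (b := (s a)[i])
      (l := (s a).drop (i + 1)) (by simp [hab]) ?_
    convert (runIn_pop a _).seq (runIn_push b _ _) using 1
    funext k
    by_cases hk : k = b
    · subst hk
      simp [hab.symm]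
      rw [List.take_succ_eq_append_getElem hi, List.reverse_append]
      rfl
    · by_cases hk' : k = a <;> simp [hk, hk', hab]

/-- Moves the contents of the stack `a` to both `b` and `c`, in reversed order. -/
def moveTwo (a b c : K) : StackProgram K :=
  loop a (caseTop a (pop a) (seq (pop a) (seq (push b false) (push c false)))
    (seq (pop a) (seq (push b true) (push c true))))

theorem runIn_moveTwo {a b c : K} (hab : a ≠ b) (hac : a ≠ c) (hbc : b ≠ c) (s : K → List Bool)
    {B : ℕ} (hB : (s a).length ≤ B) :
    RunIn (moveTwo a b c) s
      (update (update (update s a []) b ((s a).reverse ++ s b)) c ((s a).reverse ++ s c))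
      (5 * B + 1) := by
  have h := runIn_loop (k := a)
    (p := caseTop a (pop a) (seq (pop a) (seq (push b false) (push c false)))
      (seq (pop a) (seq (push b true) (push c true))))
    (T := 4) (s a).length
    (fun i => update (update (update s a ((s a).drop i)) b (((s a).take i).reverse ++ s b))
      c (((s a).take i).reverse ++ s c))
    (fun i hi => ⟨by simpa [hab, hac] using hi, ?_⟩) (by simp [hab, hac])
  · simp only [List.drop_zero, update_eq_self, List.drop_length, List.take_zero, List.take_length,
      List.reverse_nil, List.nil_append] at h
    exact h.mono (by omega)
  · refine RunIn.caseTop_cons (f := fun d => seq (pop a) (seq (push b d) (push c d)))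
      (b := (s a)[i]) (l := (s a).drop (i + 1)) (by simp [hab, hac]) ?_
    convert (runIn_pop a _).seq ((runIn_push b _ _).seq (runIn_push c _ _)) using 1
    funext k
    by_cases hk : k = c
    · subst hk
      simp [hac.symm, hbc.symm]
      rw [List.take_succ_eq_append_getElem hi, List.reverse_append]
      rfl
    · by_cases hk' : k = b
      · subst hk'
        simp [hab.symm, hk]
        rw [List.take_succ_eq_append_getElem hi, List.reverse_append]
        rfl
      · by_cases hk'' : k = a <;> simp [hk, hk', hk'', hab, hac]

end StackProgram

/-! ### Functions computed in polynomial time by stack programs -/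

open Function StackProgram

/-- The sequence that starts with `a` and continues with `e`. -/
def scons {α : Type*} (a : α) (e : ℕ → α) : ℕ → α
  | 0 => a
  | i + 1 => e i

theorem comp_scons {α β : Type*} (f : α → β) (a : α) (e : ℕ → α) :
    f ∘ scons a e = scons (f a) (f ∘ e) := by
  funext i
  cases i <;> rfl

theorem update_comp_of_ne {K α : Type*} [DecidableEq K] {loc : ℕ → K} {k : K}
    (h : ∀ i, loc i ≠ k) (s : K → α) (v : α) : update s k v ∘ loc = s ∘ loc := by
  funext i
  simp [h i]

/-- The function `g` of finitely or infinitely many bit strings is computed in polynomial time by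
stack programs, wherever the arguments, the result and the auxiliary stacks are located. -/
def PolyTime (g : (ℕ → List Bool) → List Bool) : Prop :=
  ∃ (J : ℕ) (P : Polynomial ℕ),
    (∀ e B, (∀ i, (e i).length ≤ B) → (g e).length ≤ P.eval B) ∧
    ∀ (K : Type) [DecidableEq K] (loc : ℕ → K) (o : K) (T : List K), J ≤ T.length →
      (o :: T).Nodup → (∀ i, loc i ∉ o :: T) → ∃ p : StackProgram K,
        ∀ (s : K → List Bool) (B : ℕ), (∀ k, (s k).length ≤ B) → s o = [] → (∀ k ∈ T, s k = []) →
          RunIn p s (update s o (g (s ∘ loc))) (P.eval B)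

namespace PolyTime

/-- Stacks are read destructively. The argument is moved to an auxiliary stack, and from there both
back to its place and to the result; the two reversals cancel. -/
theorem var (i : ℕ) : PolyTime fun e => e i := by
  refine ⟨1, 9 * .X + 2, fun e B h => (h i).trans (by simp; omega), ?_⟩
  intro K _ loc o T hT hnd hloc
  obtain ⟨t, T, rfl⟩ := List.exists_cons_of_length_pos hT
  have h0 := hloc i
  simp only [List.mem_cons, not_or, List.nodup_cons] at h0 hnd
  refine ⟨seq (move (loc i) t) (moveTwo t (loc i) o), fun s B hB ho ht => ?_⟩
  have h1 := runIn_move h0.2.1 s (hB _)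
  have h2 := runIn_moveTwo (a := t) (b := loc i) (c := o) (Ne.symm h0.2.1)
    (Ne.symm hnd.1.1) h0.1 (update (update s (loc i) []) t ((s (loc i)).reverse ++ s t)) (B := B)
    (by simp [ht, hB])
  convert (h1.seq h2).mono (T' := (9 * .X + 2 : Polynomial ℕ).eval B) (by simp; omega) using 1
  funext k
  by_cases hk : k = o
  · subst hk
    simp [ho, ht, hnd.1.1, Ne.symm h0.1]
  · by_cases hk' : k = loc i
    · subst hk'
      simp [hk, ht, h0.2.1]
    · by_cases hk'' : k = t
      · subst hk''
        simp [hk, hk', ht]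
      · simp [hk, hk', hk'']

theorem nil : PolyTime fun _ => [] := by
  refine ⟨0, 1, by simp, ?_⟩
  intro K _ loc o T _ _ _
  -- Popping the empty result stack serves as a program that does nothing.
  refine ⟨pop o, fun s B _ ho _ => ?_⟩
  have := runIn_pop o s
  simpa [ho] using this

theorem cons (b : Bool) {g : (ℕ → List Bool) → List Bool} (hg : PolyTime g) :
    PolyTime fun e => b :: g e := by
  obtain ⟨J, P, hP, h⟩ := hg
  refine ⟨J, P + 1, fun e B he => by simpa using hP e B he, ?_⟩
  intro K _ loc o T hT hnd hloc
  obtain ⟨p, hp⟩ := h K loc o T hT hnd hloc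
  refine ⟨seq p (push o b), fun s B hB ho ht => ?_⟩
  convert (hp s B hB ho ht).seq (runIn_push o b _) using 1 <;> simp

theorem tail {g : (ℕ → List Bool) → List Bool} (hg : PolyTime g) :
    PolyTime fun e => (g e).tail := by
  obtain ⟨J, P, hP, h⟩ := hg
  refine ⟨J, P + 1, fun e B he => ?_, ?_⟩
  · have := hP e B he
    simp
    omega
  intro K _ loc o T hT hnd hloc
  obtain ⟨p, hp⟩ := h K loc o T hT hnd hloc
  refine ⟨seq p (pop o), fun s B hB ho ht => ?_⟩
  convert (hp s B hB ho ht).seq (runIn_pop o _) using 1 <;> simp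

/-- Only the locations of the arguments change. The location map need not be injective, so variables
may be permuted, skipped or identified. -/
theorem shift (ρ : ℕ → ℕ) {g : (ℕ → List Bool) → List Bool} (hg : PolyTime g) :
    PolyTime fun e => g (e ∘ ρ) := by
  obtain ⟨J, P, hP, h⟩ := hg
  exact ⟨J, P, fun e B he => hP _ B fun i => he _, fun K _ loc o T hT hnd hloc =>
    h K (loc ∘ ρ) o T hT hnd fun i => hloc _⟩

theorem ite {c g h : (ℕ → List Bool) → List Bool} (hc : PolyTime c) (hg : PolyTime g)
    (hh : PolyTime h) : PolyTime fun e => if (c e).head? = some true then g e else h e := by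
  obtain ⟨J₁, P₁, hP₁, h₁⟩ := hc
  obtain ⟨J₂, P₂, hP₂, h₂⟩ := hg
  obtain ⟨J₃, P₃, hP₃, h₃⟩ := hh
  refine ⟨J₁ + J₂ + J₃ + 1, 3 * P₁ + P₂ + P₃ + 2, fun e B he => ?_, ?_⟩
  · have := hP₂ e B he
    have := hP₃ e B he
    dsimp only
    split_ifs <;> simp <;> omega
  intro K _ loc o T hT hnd hloc
  obtain ⟨a, T, rfl⟩ := List.exists_cons_of_length_pos (l := T) (by omega)
  simp only [List.mem_cons, not_or, List.nodup_cons, List.length_cons, forall_and] at hloc hnd hT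
  obtain ⟨p₁, hp₁⟩ := h₁ K loc a T (by omega) (List.nodup_cons.2 hnd.2) fun i => by
    simp [hloc.2.1 i, hloc.2.2 i]
  obtain ⟨p₂, hp₂⟩ := h₂ K loc o T (by omega) (List.nodup_cons.2 ⟨hnd.1.2, hnd.2.2⟩) fun i => by
    simp [hloc.1 i, hloc.2.2 i]
  obtain ⟨p₃, hp₃⟩ := h₃ K loc o T (by omega) (List.nodup_cons.2 ⟨hnd.1.2, hnd.2.2⟩) fun i => by
    simp [hloc.1 i, hloc.2.2 i]
  -- The stack with the test value is cleared in every branch, since auxiliary stacks must be empty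
  -- again at the end.
  refine ⟨seq p₁ (caseTop a (seq (clear a) p₃) (seq (clear a) p₃) (seq (clear a) p₂)),
    fun s B hB ho ht => ?_⟩
  have ha : s a = [] := ht a (by simp)
  have ht' : ∀ k ∈ T, s k = [] := fun k hk => ht k (by simp [hk])
  have hr₁ := hp₁ s B hB ha ht'
  have hr := runIn_clear a (update s a (c (s ∘ loc))) (B := P₁.eval B)
    (by rw [update_self]; exact hP₁ _ B fun i => hB _)
  simp only [update_idem] at hr
  rw [← ha, update_eq_self] at hr
  have hr₂ := hr.seq (hp₂ s B hB ho ht')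
  have hr₃ := hr.seq (hp₃ s B hB ho ht')
  dsimp only
  match hl : c (s ∘ loc) with
  | [] =>
    rw [if_neg (by simp)]
    obtain ⟨t, h4, h5⟩ := hr₃
    exact (hr₁.seq ⟨_, add_le_add h4 le_rfl, .case_nil (by simpa using hl) h5⟩).mono
      (by simp; omega)
  | false :: l =>
    rw [if_neg (by simp)]
    obtain ⟨t, h4, h5⟩ := hr₃
    exact (hr₁.seq ⟨_, add_le_add h4 le_rfl, .case_false (by simpa using hl) h5⟩).mono
      (by simp; omega)
  | true :: l =>
    rw [if_pos (by simp)]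
    obtain ⟨t, h4, h5⟩ := hr₂
    exact (hr₁.seq ⟨_, add_le_add h4 le_rfl, .case_true (by simpa using hl) h5⟩).mono
      (by simp; omega)

/-- Composition: the value of `h` stays on an auxiliary stack, which acts as variable `0` for `g`,
and is cleared afterwards. The size bound for `g` thus has to include the size of that value. -/
theorem bind {h g : (ℕ → List Bool) → List Bool} (hh : PolyTime h) (hg : PolyTime g) :
    PolyTime fun e => g (scons (h e) e) := by
  obtain ⟨J₁, P₁, hP₁, h₁⟩ := hh
  obtain ⟨J₂, P₂, hP₂, h₂⟩ := hg
  have hbd : ∀ e B, (∀ i, (e i).length ≤ B) →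
      ∀ i, (scons (h e) e i).length ≤ B + P₁.eval B := by
    rintro e B he (_ | i)
    · exact (hP₁ e B he).trans (by omega)
    · exact (he i).trans (by omega)
  refine ⟨J₁ + J₂ + 1, 3 * P₁ + P₂.comp (.X + P₁) + 1, fun e B he => ?_, ?_⟩
  · have := hP₂ _ _ (hbd e B he)
    simp
    omega
  intro K _ loc o T hT hnd hloc
  obtain ⟨a, T, rfl⟩ := List.exists_cons_of_length_pos (l := T) (by omega)
  simp only [List.mem_cons, not_or, List.nodup_cons, List.length_cons, forall_and] at hloc hnd hT
  obtain ⟨p₁, hp₁⟩ := h₁ K loc a T (by omega) (List.nodup_cons.2 hnd.2) fun i => by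
    simp [hloc.2.1 i, hloc.2.2 i]
  obtain ⟨p₂, hp₂⟩ := h₂ K (scons a loc) o T (by omega)
    (List.nodup_cons.2 ⟨hnd.1.2, hnd.2.2⟩) (by
      rintro (_ | i)
      · simp [scons, Ne.symm hnd.1.1, hnd.2.1]
      · simp [scons, hloc.1 i, hloc.2.2 i])
  refine ⟨seq p₁ (seq p₂ (clear a)), fun s B hB ho ht => ?_⟩
  have ha : s a = [] := ht a (by simp)
  have ht' : ∀ k ∈ T, s k = [] := fun k hk => ht k (by simp [hk])
  have hr₁ := hp₁ s B hB ha ht'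
  have hb₁ := hP₁ (s ∘ loc) B fun i => hB _
  have hr₂ := hp₂ (update s a (h (s ∘ loc))) (B + P₁.eval B) (fun k => by
    by_cases hk : k = a
    · subst hk
      simp only [update_self]
      omega
    · simp only [update_of_ne hk]
      exact (hB k).trans (by omega)) (by simp [hnd.1.1, ho]) (fun k hk => by
    have : k ≠ a := fun h => hnd.2.1 (h ▸ hk)
    simp [this, ht' k hk])
  rw [comp_scons, update_self, update_comp_of_ne hloc.2.1] at hr₂
  have hr₃ := runIn_clear a (update (update s a (h (s ∘ loc))) o
    (g (scons (h (s ∘ loc)) (s ∘ loc)))) (B := P₁.eval B) (by simpa [Ne.symm hnd.1.1] using hb₁)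
  convert (hr₁.seq (hr₂.seq hr₃)).mono (T' := (3 * P₁ + P₂.comp (.X + P₁) + 1).eval B)
    (by simp; omega) using 1
  funext k
  by_cases hk : k = o
  · subst hk
    simp [hnd.1.1]
  · by_cases hk' : k = a
    · subst hk'
      simp [hk, ha]
    · simp [hk, hk']

/-- Bounded iteration: `n` rounds, where `n` is the length of `h e`. The step function `g` is given
the number of the round in unary and the current value. -/
theorem iterate {h i g : (ℕ → List Bool) → List Bool} (hh : PolyTime h) (hi : PolyTime i)
    (hg : PolyTime g) (r : (ℕ → List Bool) → ℕ → List Bool) (hr0 : ∀ e, r e 0 = i e)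
    (hr : ∀ e t, r e (t + 1) = g (scons (List.replicate t true) (scons (r e t) e)))
    (hb : ∃ Q : Polynomial ℕ, ∀ e B, (∀ i, (e i).length ≤ B) → ∀ t ≤ (h e).length,
      (r e t).length ≤ Q.eval B) :
    PolyTime fun e => r e (h e).length := by
  obtain ⟨J₁, P₁, hP₁, h₁⟩ := hh
  obtain ⟨J₂, P₂, hP₂, h₂⟩ := hi
  obtain ⟨J₃, P₃, hP₃, h₃⟩ := hg
  obtain ⟨Q, hQ⟩ := hb
  have hbd : ∀ e B, (∀ i, (e i).length ≤ B) → ∀ t ≤ (h e).length,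
      ∀ i, (scons (List.replicate t true) (scons (r e t) e) i).length
        ≤ B + P₁.eval B + Q.eval B := by
    rintro e B he t ht (_ | _ | i)
    · have := hP₁ e B he
      simp only [scons, List.length_replicate]
      omega
    · have := hQ e B he t ht
      simp only [scons]
      omega
    · have := he i
      simp only [scons]
      omega
  refine ⟨J₁ + J₂ + J₃ + 5, P₁ + P₂.comp (.X + P₁) +
    (P₁ * (P₃.comp (.X + P₁ + Q) + 10 * Q + 8) + 1) + (2 * P₁ + 1) + (4 * Q + 1) + (4 * Q + 1),
    fun e B he => ?_, ?_⟩
  · have := hQ e B he _ le_rfl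
    simp
    omega
  intro K _ loc o T hT hnd hloc
  obtain ⟨c, T, rfl⟩ := List.exists_cons_of_length_pos (l := T) (by omega)
  obtain ⟨x, T, rfl⟩ := List.exists_cons_of_length_pos (l := T) (by simp at hT; omega)
  obtain ⟨a, T, rfl⟩ := List.exists_cons_of_length_pos (l := T) (by simp at hT; omega)
  obtain ⟨a', T, rfl⟩ := List.exists_cons_of_length_pos (l := T) (by simp at hT; omega)
  obtain ⟨y, T, rfl⟩ := List.exists_cons_of_length_pos (l := T) (by simp at hT; omega)
  simp only [List.mem_cons, not_or, List.nodup_cons, List.length_cons, forall_and] at hloc hnd hT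
  obtain ⟨lo, lc, lx, la, la', ly, lT⟩ := hloc
  obtain ⟨⟨oc, ox, oa, oa', oy, oT⟩, ⟨cx, ca, ca', cy, cT⟩, ⟨xa, xa', xy, xT⟩, ⟨aa', ay, aT⟩,
    ⟨a'y, a'T⟩, yT, nT⟩ := hnd
  obtain ⟨p₁, hp₁⟩ := h₁ K loc c T (by omega) (List.nodup_cons.2 ⟨cT, nT⟩) fun i => by
    simp [lc i, lT i]
  obtain ⟨p₂, hp₂⟩ := h₂ K loc a T (by omega) (List.nodup_cons.2 ⟨aT, nT⟩) fun i => by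
    simp [la i, lT i]
  obtain ⟨p₃, hp₃⟩ := h₃ K (scons x (scons a loc)) a' T (by omega)
    (List.nodup_cons.2 ⟨a'T, nT⟩) (by
      rintro (_ | _ | i)
      · simp [scons, xa', xT]
      · simp [scons, aa', aT]
      · simp [scons, la' i, lT i])
  -- The stack `c` is the countdown, `x` the number of the round, `a` the current value and `a'` the
  -- next one. Transfers pass through `y` because a single move reverses the contents.
  refine ⟨seq p₁ (seq p₂ (seq (loop c (seq (pop c) (seq p₃ (seq (clear a) (seq (move a' y)
    (seq (move y a) (push x true))))))) (seq (clear x) (seq (move a y) (move y o))))),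
    fun s B hB ho ht => ?_⟩
  have sc : s c = [] := ht c (by simp)
  have sx : s x = [] := ht x (by simp)
  have sa : s a = [] := ht a (by simp)
  have sa' : s a' = [] := ht a' (by simp)
  have sy : s y = [] := ht y (by simp)
  have ht' : ∀ k ∈ T, s k = [] := fun k hk => ht k (by simp [hk])
  have Tne : ∀ {z : K}, z ∉ T → ∀ k ∈ T, k ≠ z := fun hz k hk h => hz (h ▸ hk)
  have he : ∀ i, ((s ∘ loc) i).length ≤ B := fun i => hB _
  generalize hE : s ∘ loc = E at he
  have hb₁ := hP₁ E B he
  have hr₁ := hp₁ s B hB sc ht'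
  rw [hE] at hr₁
  have hr₂ := hp₂ (update s c (h E)) (B + P₁.eval B) (fun k => by
    by_cases hk : k = c
    · subst hk
      simp only [update_self]
      omega
    · simp only [update_of_ne hk]
      exact (hB k).trans (by omega)) (by simp [Ne.symm ca, sa]) (fun k hk => by
    simp [Tne cT k hk, ht' k hk])
  rw [update_comp_of_ne lc, hE] at hr₂
  -- The invariant: after `t` rounds, `c` has lost `t` symbols, `x` has received `t`, and `a` holds
  -- the `t`-th value.
  have hr₃ := runIn_loop (k := c) (p := seq (pop c) (seq p₃ (seq (clear a) (seq (move a' y)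
    (seq (move y a) (push x true)))))) (T := P₃.eval (B + P₁.eval B + Q.eval B) + 10 * Q.eval B + 7)
    (h E).length
    (fun t => update (update (update s c ((h E).drop t)) x (List.replicate t true)) a (r E t))
    (fun t ht₁ => ⟨by simpa [ca, cx] using ht₁, ?_⟩) (by simp [ca, cx])
  · rw [hr0] at hr₃
    simp only [List.replicate_zero, List.drop_zero, List.drop_length] at hr₃
    have e0 : update (update s c (h E)) x [] = update s c (h E) := by
      rw [← sx, update_eq_self_iff]
      simp [Ne.symm cx]
    have e1 : update s c [] = s := by rw [← sc, update_eq_self]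
    rw [e0, e1] at hr₃
    have hr₄ := runIn_clear x (update (update s x (List.replicate (h E).length true)) a
      (r E (h E).length)) (B := P₁.eval B) (by simpa [xa] using hb₁)
    have e2 : update (update (update s x (List.replicate (h E).length true)) a
        (r E (h E).length)) x [] = update s a (r E (h E).length) := by
      rw [update_comm xa, update_idem, update_comm (Ne.symm xa), ← sx, update_eq_self]
    rw [e2] at hr₄
    have hbQ := hQ E B he _ le_rfl
    have hr₅ := runIn_move ay (update s a (r E (h E).length)) (B := Q.eval B) (by simpa using hbQ)
    have hr₆ := runIn_move (Ne.symm oy) (update (update (update s a (r E (h E).length)) a []) y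
      ((update s a (r E (h E).length) a).reverse ++ update s a (r E (h E).length) y))
      (B := Q.eval B) (by simpa [Ne.symm ay, sy] using hbQ)
    have hr₇ := (hr₁.seq (hr₂.seq (hr₃.seq (hr₄.seq (hr₅.seq hr₆))))).mono (T' :=
      ((P₁ + P₂.comp (.X + P₁) +
        (P₁ * (P₃.comp (.X + P₁ + Q) + 10 * Q + 8) + 1) + (2 * P₁ + 1) + (4 * Q + 1) +
        (4 * Q + 1)).eval B)) ?_
    rotate_left
    · have := Nat.mul_le_mul_right
        (P₃.eval (B + P₁.eval B + Q.eval B) + 10 * Q.eval B + 8) hb₁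
      have e9 : P₃.eval (B + P₁.eval B + Q.eval B) + 10 * Q.eval B + 7 + 1 =
        P₃.eval (B + P₁.eval B + Q.eval B) + 10 * Q.eval B + 8 := rfl
      rw [e9]
      simp only [Polynomial.eval_add, Polynomial.eval_mul, Polynomial.eval_comp, Polynomial.eval_X,
        Polynomial.eval_ofNat, Polynomial.eval_one]
      omega
    · convert hr₇ using 1
      funext k
      by_cases hk : k = o
      · subst hk
        simp [Ne.symm ay, oy, oa, sy, ho]
      · by_cases hk' : k = y
        · subst hk'
          simp [hk, sy]
        · by_cases hk'' : k = a
          · subst hk''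
            simp [hk, hk', sa]
          · simp [hk, hk', hk'']
  · have ht₂ : t ≤ (h E).length := ht₁.le
    have hbt := hbd E B he t ht₂
    have hbt₁ : (r E t).length ≤ Q.eval B := hQ E B he t ht₂
    have hbt₂ : (r E (t + 1)).length ≤ Q.eval B := hQ E B he (t + 1) ht₁
    have q₁ := runIn_pop c
      (update (update (update s c ((h E).drop t)) x (List.replicate t true)) a (r E t))
    have e1 : update (update (update (update s c ((h E).drop t)) x (List.replicate t true)) a
        (r E t)) c (update (update (update s c ((h E).drop t)) x (List.replicate t true)) a
        (r E t) c).tail =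
        update (update (update s c ((h E).drop (t + 1))) x (List.replicate t true)) a (r E t) := by
      rw [update_comm (Ne.symm ca), update_comm (Ne.symm cx), update_idem]
      simp [ca, cx]
    rw [e1] at q₁
    generalize hS : update (update (update s c ((h E).drop (t + 1))) x (List.replicate t true)) a
      (r E t) = S at q₁
    have Sx : S x = List.replicate t true := by simp [← hS, xa]
    have Sa : S a = r E t := by simp [← hS]
    have Sa' : S a' = [] := by simp [← hS, Ne.symm aa', Ne.symm xa', Ne.symm ca', sa']
    have Sy : S y = [] := by simp [← hS, Ne.symm ay, Ne.symm xy, Ne.symm cy, sy]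
    have Sloc : S ∘ loc = E := by
      rw [← hS, update_comp_of_ne la, update_comp_of_ne lx, update_comp_of_ne lc, hE]
    have q₂ := hp₃ S (B + P₁.eval B + Q.eval B) (fun k => by
      have := hB k
      rw [← hS]
      simp only [update_apply]
      split_ifs
      · omega
      · simp only [List.length_replicate]
        omega
      · simp only [List.length_drop]
        omega
      · omega) Sa' (fun k hk => by
        simp [← hS, Tne aT k hk, Tne xT k hk, Tne cT k hk, ht' k hk])
    rw [comp_scons, comp_scons, Sx, Sa, Sloc, ← hr] at q₂
    have q₃ := runIn_clear a (update S a' (r E (t + 1))) (B := Q.eval B)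
      (by simpa [aa', Sa] using hbt₁)
    have q₄ := runIn_move a'y (update (update S a' (r E (t + 1))) a []) (B := Q.eval B)
      (by simpa [Ne.symm aa'] using hbt₂)
    have q₅ := runIn_move (Ne.symm ay) (update (update (update (update S a' (r E (t + 1))) a [])
      a' []) y ((update (update S a' (r E (t + 1))) a [] a').reverse ++
        update (update S a' (r E (t + 1))) a [] y)) (B := Q.eval B)
      (by simpa [Ne.symm aa', Ne.symm ay, Ne.symm a'y, Sy] using hbt₂)
    have q₆ := runIn_push x true (update (update (update (update (update (update S a'
      (r E (t + 1))) a []) a' []) y ((update (update S a' (r E (t + 1))) a [] a').reverse ++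
        update (update S a' (r E (t + 1))) a [] y)) y []) a (r E (t + 1)))
    have e2 : ((update (update (update (update S a' (r E (t + 1))) a [])
      a' []) y ((update (update S a' (r E (t + 1))) a [] a').reverse ++
        update (update S a' (r E (t + 1))) a [] y)) y).reverse ++ (update (update (update
          (update S a' (r E (t + 1))) a []) a' []) y ((update (update S a' (r E (t + 1))) a []
            a').reverse ++ update (update S a' (r E (t + 1))) a [] y)) a = r E (t + 1) := by
      simp [Ne.symm aa', ay, aa', Ne.symm ay, Ne.symm a'y, Sy]
    rw [e2] at q₅
    convert (q₁.seq (q₂.seq (q₃.seq (q₄.seq (q₅.seq q₆))))).mono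
      (T' := P₃.eval (B + P₁.eval B + Q.eval B) + 10 * Q.eval B + 7) (by omega) using 1
    funext k
    by_cases hk : k = x
    · subst hk
      simp [xa, xy, xa', Sx, List.replicate_succ]
    · by_cases hk' : k = a
      · subst hk'
        simp [hk]
      · by_cases h3 : k = y
        · subst h3
          simp [hk, hk', Ne.symm cy, sy]
        · by_cases h4 : k = a'
          · subst h4
            simp [hk, hk', h3, Ne.symm ca', sa']
          · simp [hk, hk', h3, h4, ← hS]

end PolyTime

/-- A Turing machine for a predicate that is computed in polynomial time by stack programs. -/
theorem PolyTime.nonempty_tm2ComputableInPolyTime {α : Type} {enc : α → List Bool} {f : α → Bool}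
    {g : (ℕ → List Bool) → List Bool} (hg : PolyTime g) (h : ∀ a, g (fun _ => enc a) = [f a]) :
    Nonempty (Turing.TM2ComputableInPolyTime enc Computability.encodeBool f) := by
  obtain ⟨J, P, -, hP⟩ := hg
  -- The stack `none` carries the input, which serves as every variable at once; `some none` carries
  -- the output, and the other stacks are auxiliary.
  obtain ⟨p, hp⟩ := hP (Option (Option (Fin J))) (fun _ => none) (some none)
    ((List.finRange J).map fun i => some (some i)) (by simp) (by
      refine List.nodup_cons.2 ⟨by simp, (List.nodup_finRange J).map ?_⟩
      intro i j hij
      simpa using hij) (by simp)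
  have key : ∀ a, RunIn (seq p (clear none))
      (update (fun _ => []) (none : Option (Option (Fin J))) (enc a))
      (update (fun _ => []) (some none) [f a])
      (P.eval (enc a).length + (2 * (enc a).length + 1)) := by
    intro a
    have h1 := hp (update (fun _ => []) none (enc a)) (enc a).length (fun k => by
      by_cases hk : k = none <;> simp [hk]) (by simp) (by simp)
    have h0 : update (fun _ => []) (none : Option (Option (Fin J))) (enc a) ∘
      (fun _ : ℕ => none) = fun _ => enc a := by
      funext i
      simp
    rw [h0, h] at h1
    have h2 := runIn_clear (none : Option (Option (Fin J))) (update (update (fun _ => []) none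
      (enc a)) (some none) [f a]) (B := (enc a).length) (by simp)
    convert h1.seq h2 using 1
    funext k
    by_cases hk : k = none
    · subst hk
      simp
    · by_cases hk' : k = some none <;> simp [hk, hk']
  choose t ht hrun using key
  refine ⟨⟨⟨machine (seq p (clear none)) none (some none), Equiv.refl _, Equiv.refl _⟩,
    P + (2 * .X + 2), fun a => Classical.choice ?_⟩⟩
  have h3 := (hrun a).outputsInTime (T := (P + (2 * .X + 2) : Polynomial ℕ).eval (enc a).length)
    (by have := ht a; simp; omega)
  have e1 : List.map (Equiv.refl Bool).invFun (enc a) = enc a := List.map_id _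
  exact e1.symm ▸ h3

/-! ### Closure properties of polynomial time -/

open Function

open scoped Classical in
/-- A predicate decided in polynomial time. -/
def PolyTimePred (φ : (ℕ → List Bool) → Prop) : Prop :=
  PolyTime fun e => if φ e then [true] else []

/-- A function with values in `ℕ` computed in polynomial time, with the result in unary. -/
def PolyTimeNat (f : (ℕ → List Bool) → ℕ) : Prop :=
  PolyTime fun e => List.replicate (f e) true

namespace PolyTimePred

open scoped Classical in
theorem ite {φ : (ℕ → List Bool) → Prop} {g h : (ℕ → List Bool) → List Bool}
    (hφ : PolyTimePred φ) (hg : PolyTime g) (hh : PolyTime h) :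
    PolyTime fun e => if φ e then g e else h e := by
  convert PolyTime.ite hφ hg hh using 2 with e
  by_cases h : φ e <;> simp [h]

theorem of_iff {φ ψ : (ℕ → List Bool) → Prop} (hφ : PolyTimePred φ) (h : ∀ e, ψ e ↔ φ e) :
    PolyTimePred ψ := by
  rwa [show ψ = φ from funext fun e => propext (h e)]

theorem head {l : (ℕ → List Bool) → List Bool} (hl : PolyTime l) :
    PolyTimePred fun e => (l e).head? = some true := by
  classical
  unfold PolyTimePred
  convert PolyTime.ite hl (PolyTime.nil.cons true) PolyTime.nil using 2 with e
  by_cases h : (l e).head? = some true <;> simp [h]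

theorem shift (ρ : ℕ → ℕ) {φ : (ℕ → List Bool) → Prop} (hφ : PolyTimePred φ) :
    PolyTimePred fun e => φ (e ∘ ρ) :=
  PolyTime.shift ρ hφ

theorem and {φ ψ : (ℕ → List Bool) → Prop} (hφ : PolyTimePred φ) (hψ : PolyTimePred ψ) :
    PolyTimePred fun e => φ e ∧ ψ e := by
  classical
  unfold PolyTimePred
  convert hφ.ite hψ PolyTime.nil using 2 with e
  by_cases h : φ e <;> simp [h]

theorem not {φ : (ℕ → List Bool) → Prop} (hφ : PolyTimePred φ) : PolyTimePred fun e => ¬ φ e := by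
  classical
  unfold PolyTimePred
  convert hφ.ite PolyTime.nil (PolyTime.nil.cons true) using 2 with e
  by_cases h : φ e <;> simp [h]

theorem or {φ ψ : (ℕ → List Bool) → Prop} (hφ : PolyTimePred φ) (hψ : PolyTimePred ψ) :
    PolyTimePred fun e => φ e ∨ ψ e :=
  (hφ.not.and hψ.not).not.of_iff fun e => by tauto

theorem imp {φ ψ : (ℕ → List Bool) → Prop} (hφ : PolyTimePred φ) (hψ : PolyTimePred ψ) :
    PolyTimePred fun e => φ e → ψ e :=
  (hφ.not.or hψ).of_iff fun e => by tauto

end PolyTimePred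

namespace PolyTimeNat

theorem length {l : (ℕ → List Bool) → List Bool} (hl : PolyTime l) :
    PolyTimeNat fun e => (l e).length :=
  PolyTime.iterate hl PolyTime.nil ((PolyTime.var 1).cons true)
    (fun _ t => List.replicate t true) (fun _ => rfl) (fun _ _ => List.replicate_succ)
    (by
      obtain ⟨J, P, hP, -⟩ := hl
      exact ⟨P, fun e B he t ht => by simpa using ht.trans (hP e B he)⟩)

theorem var (i : ℕ) : PolyTimeNat fun e => (e i).length :=
  length (PolyTime.var i)

theorem bound {f : (ℕ → List Bool) → ℕ} (hf : PolyTimeNat f) :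
    ∃ P : Polynomial ℕ, ∀ e B, (∀ i, (e i).length ≤ B) → f e ≤ P.eval B := by
  obtain ⟨J, P, hP, -⟩ := hf
  exact ⟨P, fun e B he => by simpa using hP e B he⟩

theorem iterate {n : (ℕ → List Bool) → ℕ} {i g : (ℕ → List Bool) → List Bool}
    (hn : PolyTimeNat n) (hi : PolyTime i) (hg : PolyTime g)
    (r : (ℕ → List Bool) → ℕ → List Bool) (hr0 : ∀ e, r e 0 = i e)
    (hr : ∀ e t, r e (t + 1) = g (scons (List.replicate t true) (scons (r e t) e)))
    (hb : ∃ Q : Polynomial ℕ, ∀ e B, (∀ i, (e i).length ≤ B) → ∀ t ≤ n e,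
      (r e t).length ≤ Q.eval B) :
    PolyTime fun e => r e (n e) := by
  convert PolyTime.iterate hn hi hg r hr0 hr (by simpa using hb) using 3
  simp

theorem shift (ρ : ℕ → ℕ) {f : (ℕ → List Bool) → ℕ} (hf : PolyTimeNat f) :
    PolyTimeNat fun e => f (e ∘ ρ) :=
  PolyTime.shift ρ hf

theorem succ {f : (ℕ → List Bool) → ℕ} (hf : PolyTimeNat f) : PolyTimeNat fun e => f e + 1 :=
  PolyTime.cons true hf

theorem const (c : ℕ) : PolyTimeNat fun _ => c := by
  induction c with
  | zero => exact PolyTime.nil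
  | succ c ih => exact ih.succ

theorem append {f : (ℕ → List Bool) → ℕ} {l : (ℕ → List Bool) → List Bool} (hf : PolyTimeNat f)
    (hl : PolyTime l) : PolyTime fun e => List.replicate (f e) true ++ l e :=
  hf.iterate hl ((PolyTime.var 1).cons true) (fun e t => List.replicate t true ++ l e)
    (fun _ => rfl) (fun _ _ => rfl) (by
      obtain ⟨P, hP⟩ := hf.bound
      obtain ⟨J, Q, hQ, -⟩ := hl
      refine ⟨P + Q, fun e B he t ht => ?_⟩
      have := hP e B he
      have := hQ e B he
      simp
      omega)

theorem add {f g : (ℕ → List Bool) → ℕ} (hf : PolyTimeNat f) (hg : PolyTimeNat g) :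
    PolyTimeNat fun e => f e + g e := by
  unfold PolyTimeNat
  convert hf.append hg using 2
  simp

theorem mul {f g : (ℕ → List Bool) → ℕ} (hf : PolyTimeNat f) (hg : PolyTimeNat g) :
    PolyTimeNat fun e => f e * g e :=
  hf.iterate PolyTime.nil ((hg.shift (· + 2)).append (PolyTime.var 1))
    (fun e t => List.replicate (t * g e) true) (fun _ => by simp)
    (fun e t => by
      change _ = List.replicate (g e) true ++ List.replicate (t * g e) true
      simp [add_mul, add_comm]) (by
      obtain ⟨P, hP⟩ := hf.bound
      obtain ⟨Q, hQ⟩ := hg.bound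
      refine ⟨P * Q, fun e B he t ht => ?_⟩
      simpa using Nat.mul_le_mul (ht.trans (hP e B he)) (hQ e B he))

end PolyTimeNat

theorem PolyTime.drop {l : (ℕ → List Bool) → List Bool} {f : (ℕ → List Bool) → ℕ}
    (hl : PolyTime l) (hf : PolyTimeNat f) : PolyTime fun e => (l e).drop (f e) :=
  hf.iterate hl (PolyTime.var 1).tail (fun e t => (l e).drop t)
    (fun _ => rfl) (fun e t => by simp [scons]) (by
      obtain ⟨J, P, hP, -⟩ := hl
      refine ⟨P, fun e B he t ht => ?_⟩
      have := hP e B he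
      simp
      omega)

theorem PolyTimePred.natIte {φ : (ℕ → List Bool) → Prop} {f g : (ℕ → List Bool) → ℕ} [∀ e, Decidable (φ e)]
    (hφ : PolyTimePred φ) (hf : PolyTimeNat f) (hg : PolyTimeNat g) :
    PolyTimeNat fun e => if φ e then f e else g e := by
  unfold PolyTimeNat
  convert hφ.ite hf hg using 2 with e
  by_cases h : φ e <;> simp [h]

namespace PolyTimeNat

theorem sub {f g : (ℕ → List Bool) → ℕ} (hf : PolyTimeNat f) (hg : PolyTimeNat g) :
    PolyTimeNat fun e => f e - g e := by
  unfold PolyTimeNat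
  convert PolyTime.drop hf hg using 2
  simp

theorem lt {f g : (ℕ → List Bool) → ℕ} (hf : PolyTimeNat f) (hg : PolyTimeNat g) :
    PolyTimePred fun e => f e < g e :=
  (PolyTimePred.head (hg.sub hf)).of_iff fun e => by
    rw [List.head?_replicate]
    by_cases h : g e - f e = 0 <;> simp [h] <;> omega

theorem eq {f g : (ℕ → List Bool) → ℕ} (hf : PolyTimeNat f) (hg : PolyTimeNat g) :
    PolyTimePred fun e => f e = g e :=
  ((hf.lt hg).not.and (hg.lt hf).not).of_iff fun e => by omega

theorem even {f : (ℕ → List Bool) → ℕ} (hf : PolyTimeNat f) : PolyTimePred fun e => Even (f e) := by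
  classical
  have hr : ∀ (e : ℕ → List Bool) (t : ℕ), (if Even (t + 1) then [true] else []) =
      if (if Even t then [true] else []).head? = some true then [] else [true] := by
    intro e t
    by_cases h : Even t <;> simp [h, Nat.even_add_one]
  unfold PolyTimePred
  convert hf.iterate (PolyTime.nil.cons true)
    (PolyTime.ite (PolyTime.var 1) PolyTime.nil (PolyTime.nil.cons true))
    (fun _ t => if Even t then [true] else []) (by simp) hr
    ⟨1, fun e B he t ht => by split_ifs <;> simp⟩

/-- A loop keeps the disjunction of the instances tried so far. The quantified number is passed in
unary as variable `0`, as in de Bruijn notation. -/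
theorem exists_lt {n : (ℕ → List Bool) → ℕ} {φ : ℕ → (ℕ → List Bool) → Prop} (hn : PolyTimeNat n)
    (hφ : PolyTimePred fun e => φ (e 0).length fun i => e (i + 1)) :
    PolyTimePred fun e => ∃ i < n e, φ i e := by
  classical
  have hb : PolyTimePred fun e => (e 1).head? = some true ∨ φ (e 0).length fun i => e (i + 2) :=
    (PolyTimePred.head (PolyTime.var 1)).or
      -- Variable `1` of the loop body, the disjunction so far, is hidden from `φ`.
      (hφ.shift fun | 0 => 0 | i + 1 => i + 2)
  unfold PolyTimePred
  convert hn.iterate PolyTime.nil hb (fun e t => if ∃ i < t, φ i e then [true] else [])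
    (by simp) ?_ ⟨1, fun e B he t ht => by split_ifs <;> simp⟩
  intro e t
  have e1 : (∃ i < t + 1, φ i e) ↔ (∃ i < t, φ i e) ∨ φ t e := by
    constructor
    · rintro ⟨i, hi, h⟩
      rcases Nat.lt_succ_iff_lt_or_eq.1 hi with hi | rfl
      · exact Or.inl ⟨i, hi, h⟩
      · exact Or.inr h
    · rintro (⟨i, hi, h⟩ | h)
      · exact ⟨i, hi.trans (Nat.lt_succ_self t), h⟩
      · exact ⟨t, Nat.lt_succ_self t, h⟩
  have e2 : ((if ∃ i < t, φ i e then [true] else []).head? = some true) ↔ ∃ i < t, φ i e := by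
    split_ifs with h <;> simp [h]
  simp only [e1, scons, List.length_replicate, e2]

theorem forall_lt {n : (ℕ → List Bool) → ℕ} {φ : ℕ → (ℕ → List Bool) → Prop} (hn : PolyTimeNat n)
    (hφ : PolyTimePred fun e => φ (e 0).length fun i => e (i + 1)) :
    PolyTimePred fun e => ∀ i < n e, φ i e :=
  (hn.exists_lt (φ := fun i e => ¬ φ i e) hφ.not).not.of_iff fun e => by
    push Not
    rfl

theorem getElem_eq_true {l : (ℕ → List Bool) → List Bool} {f : (ℕ → List Bool) → ℕ}
    (hf : PolyTimeNat f) (hl : PolyTime l) : PolyTimePred fun e => (l e)[f e]? = some true :=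
  (PolyTimePred.head (hl.drop hf)).of_iff fun e => by simp

open scoped Classical in
/-- The bit string listing the truth values of a predicate. -/
theorem map_range {n : (ℕ → List Bool) → ℕ} {φ : ℕ → (ℕ → List Bool) → Prop} (hn : PolyTimeNat n)
    (hφ : PolyTimePred fun e => φ (e 0).length fun i => e (i + 1)) :
    PolyTime fun e => (List.range (n e)).map fun i => decide (φ i e) := by
  -- Bits can only be prepended, so round `t` computes the entry with index `n - 1 - t`.
  have hψ : PolyTimePred fun e =>
      φ (n (fun i => e (i + 2)) - 1 - (e 0).length) fun i => e (i + 2) :=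
    (((hn.shift (· + 2)).sub (const 1)).sub (var 0)).bind
      (hφ.shift fun | 0 => 0 | i + 1 => i + 3) |> fun h => by
        simpa only [PolyTimePred, Function.comp_def, scons, List.length_replicate] using h
  have h := hn.iterate PolyTime.nil
    (hψ.ite ((PolyTime.var 1).cons true) ((PolyTime.var 1).cons false))
    (fun e t => ((List.range t).map fun i => decide (φ (n e - 1 - i) e)).reverse)
    (by simp) ?_ ?_
  · convert h using 2 with e
    refine List.ext_getElem (by simp) fun i h1 h2 => ?_
    simp only [List.getElem_map, List.getElem_range, List.getElem_reverse, List.length_map,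
      List.length_range]
    simp only [List.length_map, List.length_range] at h1
    rw [show n e - 1 - (n e - 1 - i) = i by omega]
  · intro e t
    simp only [scons, List.length_replicate, List.range_succ, List.map_append, List.map_cons,
      List.map_nil, List.reverse_append, List.reverse_cons, List.reverse_nil, List.nil_append,
      List.cons_append]
    by_cases h : φ (n e - 1 - t) e <;> simp [h]
  · obtain ⟨P, hP⟩ := hn.bound
    exact ⟨P, fun e B he t ht => by simpa using ht.trans (hP e B he)⟩

end PolyTimeNat

/-! ### Reading lists of unary numbers -/

/-- The number that is coded in unary at the beginning of a bit string. -/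
def headNat (w : List Bool) : ℕ := (w.takeWhile id).length

/-- The bit string without the number that is coded at its beginning. -/
def dropNat (w : List Bool) : List Bool := w.drop (headNat w + 1)

/-- The `j`-th number in a concatenation of numbers coded in unary. -/
def nthNat (w : List Bool) (j : ℕ) : ℕ := headNat (dropNat^[j] w)

theorem getElem?_eq_some_true_of_lt {w : List Bool} {i : ℕ} (h : i < headNat w) :
    w[i]? = some true := by
  induction w generalizing i with
  | nil => simp [headNat] at h
  | cons b w ih =>
    cases b
    · simp [headNat] at h
    · cases i with
      | zero => rfl
      | succ i => exact ih (by simpa [headNat] using h)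

theorem getElem?_headNat_ne (w : List Bool) : w[headNat w]? ≠ some true := by
  induction w with
  | nil => simp
  | cons b w ih =>
    cases b
    · simp [headNat]
    · simpa [headNat] using ih

theorem headNat_le_length (w : List Bool) : headNat w ≤ w.length :=
  (List.takeWhile_prefix _).length_le

theorem PolyTime.headNat {l : (ℕ → List Bool) → List Bool} (hl : PolyTime l) :
    PolyTimeNat fun e => headNat (l e) := by
  classical
  -- The inspected position is the length of the accumulator and not the number of the round, so the
  -- count stays put once it reaches the first position that does not hold `true`.
  have hb : PolyTimePred fun e => (l fun i => e (i + 2))[(e 1).length]? = some true :=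
    PolyTimeNat.getElem_eq_true (PolyTimeNat.var 1) (hl.shift (· + 2))
  have h := PolyTime.iterate hl PolyTime.nil
    (hb.ite ((PolyTime.var 1).cons true) (PolyTime.var 1))
    (fun e t => List.replicate (min t (_root_.headNat (l e))) true) (by simp) ?_ ?_
  · unfold PolyTimeNat
    convert h using 3 with e
    exact (min_eq_right (headNat_le_length _)).symm
  · intro e t
    simp only [scons, List.length_replicate]
    rcases lt_or_ge t (_root_.headNat (l e)) with h | h
    · rw [min_eq_left h.le, min_eq_left (Nat.succ_le_of_lt h),
        if_pos (getElem?_eq_some_true_of_lt h), List.replicate_succ]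
    · rw [min_eq_right h, min_eq_right (h.trans (Nat.le_succ t)),
        if_neg (getElem?_headNat_ne _)]
  · obtain ⟨J, P, hP, -⟩ := hl
    refine ⟨P, fun e B he t ht => ?_⟩
    have := hP e B he
    simp
    omega

theorem length_iterate_dropNat_le (w : List Bool) (j : ℕ) :
    (dropNat^[j] w).length ≤ w.length := by
  induction j with
  | zero => rfl
  | succ j ih =>
    rw [iterate_succ_apply']
    refine le_trans ?_ ih
    simp [dropNat]

theorem PolyTime.nthNat {l : (ℕ → List Bool) → List Bool} {f : (ℕ → List Bool) → ℕ}
    (hl : PolyTime l) (hf : PolyTimeNat f) : PolyTimeNat fun e => nthNat (l e) (f e) := by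
  refine PolyTime.headNat ?_
  refine hf.iterate hl ((PolyTime.var 1).drop (PolyTime.var 1).headNat.succ)
    (fun e t => dropNat^[t] (l e)) (fun _ => rfl)
    (fun e t => iterate_succ_apply' ..) ?_
  obtain ⟨J, P, hP, -⟩ := hl
  exact ⟨P, fun e B he t ht => (length_iterate_dropNat_le _ _).trans (hP e B he)⟩

/-! ### Reachability in finite graphs -/

/-- The iterates from `∅` increase, and they are constant once two consecutive ones agree. Otherwise
`M + 1` strict increases would produce a subset of `range M` with `M + 1` elements. -/
theorem eq_succ_of_monotone_of_subset_range {Φ : Finset ℕ → Finset ℕ} (hΦ : Monotone Φ) {M : ℕ}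
    (hM : ∀ S, Φ S ⊆ Finset.range M) : Φ (Φ^[M] ∅) = Φ^[M] ∅ := by
  have hmono : ∀ t, Φ^[t] ∅ ⊆ Φ^[t + 1] ∅ := by
    intro t
    induction t with
    | zero => simp
    | succ t ih =>
      rw [iterate_succ_apply', iterate_succ_apply' (n := t + 1)]
      exact hΦ ih
  by_contra hne
  have hne' : ∀ t ≤ M, Φ^[t] ∅ ≠ Φ^[t + 1] ∅ := by
    intro t ht h
    apply hne
    have : ∀ s, Φ^[t + s] ∅ = Φ^[t] ∅ := by
      intro s
      induction s with
      | zero => rfl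
      | succ s ih => rw [← add_assoc, iterate_succ_apply', ih, ← iterate_succ_apply' Φ, ← h]
    obtain ⟨s, rfl⟩ := Nat.exists_eq_add_of_le ht
    rw [this, ← iterate_succ_apply' Φ, ← h]
  have hcard : ∀ t ≤ M + 1, t ≤ (Φ^[t] ∅).card := by
    intro t
    induction t with
    | zero => simp
    | succ t ih =>
      intro ht
      exact Nat.lt_of_le_of_lt (ih (by omega))
        (Finset.card_lt_card ((hmono t).ssubset_of_ne (hne' t (by omega))))
  have h1 := hcard (M + 1) le_rfl
  have h2 : (Φ^[M + 1] ∅).card ≤ M := by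
    rw [iterate_succ_apply']
    simpa using Finset.card_le_card (hM (Φ^[M] ∅))
  omega

open scoped Classical in
/-- The bit string of the numbers below `M` that can be reached from `u` by at least one and at most
`t` edges `E`. -/
noncomputable def reachBits (M : ℕ) (E : ℕ → ℕ → Prop) (u : ℕ) : ℕ → List Bool
  | 0 => []
  | t + 1 => (List.range M).map fun v =>
    decide (E u v ∨ ∃ x < M, (reachBits M E u t)[x]? = some true ∧ E x v)

/-- The bit strings encode the iterates of a monotone operator on subsets of `range M`, so `M`
rounds reach the least fixed point. Only targets of edges are bounded by `M`; the source `u` need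
not be, which is why the first edge has its own disjunct. -/
theorem reachBits_getElem (M : ℕ) (E : ℕ → ℕ → Prop) (u v : ℕ) :
    (reachBits M E u M)[v]? = some true ↔ Relation.TransGen (fun a b => E a b ∧ b < M) u v := by
  classical
  have hs : ∀ t v, (reachBits M E u (t + 1))[v]? = some true ↔
      v < M ∧ (E u v ∨ ∃ x < M, (reachBits M E u t)[x]? = some true ∧ E x v) := by
    intro t v
    rw [reachBits, List.getElem?_map]
    rcases lt_or_ge v M with h | h
    · simp [h]
    · simp [h.not_gt]
  set Φ : Finset ℕ → Finset ℕ := fun S => {v ∈ Finset.range M | E u v ∨ ∃ x ∈ S, E x v} with hΦ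
  have hS : ∀ t v, v ∈ Φ^[t] ∅ ↔ (reachBits M E u t)[v]? = some true := by
    intro t
    induction t with
    | zero => simp [reachBits]
    | succ t ih =>
      intro v
      rw [iterate_succ_apply', hs]
      simp only [hΦ, Finset.mem_filter, Finset.mem_range]
      refine and_congr_right fun _ => or_congr_right (exists_congr fun x => ?_)
      rw [ih]
      constructor
      · rintro ⟨h1, h2⟩
        refine ⟨?_, h1, h2⟩
        cases t with
        | zero => simp [reachBits] at h1
        | succ t => exact ((hs t x).1 h1).1
      · exact fun h => h.2
  rw [← hS]
  have hfix : Φ (Φ^[M] ∅) = Φ^[M] ∅ := by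
    refine eq_succ_of_monotone_of_subset_range (fun S T hST v hv => ?_) fun S v hv => ?_
    · simp only [hΦ, Finset.mem_filter] at hv ⊢
      exact ⟨hv.1, hv.2.imp_right fun ⟨x, hx, h⟩ => ⟨x, hST hx, h⟩⟩
    · simp only [hΦ, Finset.mem_filter] at hv
      exact hv.1
  have hmem : ∀ v, v ∈ Φ^[M] ∅ ↔ v < M ∧ (E u v ∨ ∃ x ∈ Φ^[M] ∅, E x v) := by
    intro v
    conv_lhs => rw [← hfix]
    simp [hΦ]
  constructor
  · have : ∀ t v, v ∈ Φ^[t] ∅ → Relation.TransGen (fun a b => E a b ∧ b < M) u v := by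
      intro t
      induction t with
      | zero => simp
      | succ t ih =>
        intro v hv
        rw [iterate_succ_apply'] at hv
        simp only [hΦ, Finset.mem_filter, Finset.mem_range] at hv
        rcases hv.2 with h | ⟨x, hx, h⟩
        · exact .single ⟨h, hv.1⟩
        · exact (ih x hx).tail ⟨h, hv.1⟩
    exact this M v
  · intro h
    induction h with
    | single h => exact (hmem _).2 ⟨h.2, Or.inl h.1⟩
    | tail _ h ih => exact (hmem _).2 ⟨h.2, Or.inr ⟨_, ih, h.1⟩⟩

/-- Reachability is decidable in polynomial time. -/
theorem PolyTimePred.transGen {M u v : (ℕ → List Bool) → ℕ}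
    {E : ℕ → ℕ → (ℕ → List Bool) → Prop} (hM : PolyTimeNat M)
    (hE : PolyTimePred fun e => E (e 0).length (e 1).length fun i => e (i + 2))
    (hu : PolyTimeNat u) (hv : PolyTimeNat v) :
    PolyTimePred fun e => Relation.TransGen (fun a b => E a b e ∧ b < M e) (u e) (v e) := by
  classical
  -- In the loop body, variable `0` is the candidate vertex, `1` the round, `2` the bits found so
  -- far, and the original variables start at `3`.
  have h1 : PolyTimePred fun e => E (u fun i => e (i + 3)) (e 0).length fun i => e (i + 3) :=
    (hu.shift (· + 3)).bind (hE.shift fun | 0 => 0 | 1 => 1 | i + 2 => i + 4) |> fun h => by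
      simpa only [PolyTimePred, Function.comp_def, scons, List.length_replicate] using h
  have h2 : PolyTimePred fun e => ∃ x < M (fun i => e (i + 3)), (e 2)[x]? = some true ∧
      E x (e 0).length fun i => e (i + 3) :=
    (hM.shift (· + 3)).exists_lt (φ := fun x e => (e 2)[x]? = some true ∧
      E x (e 0).length fun i => e (i + 3))
      (((PolyTimeNat.var 0).getElem_eq_true (PolyTime.var 3)).and
        (hE.shift fun | 0 => 0 | 1 => 1 | i + 2 => i + 4))
  have h3 : PolyTime fun e => reachBits (M e) (fun a b => E a b e) (u e) (M e) := by
    refine hM.iterate PolyTime.nil (((hM.shift (· + 2))).map_range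
      (φ := fun v e => E (u fun i => e (i + 2)) v (fun i => e (i + 2)) ∨
        ∃ x < M (fun i => e (i + 2)), (e 1)[x]? = some true ∧ E x v fun i => e (i + 2))
        (h1.or h2))
      (fun e t => reachBits (M e) (fun a b => E a b e) (u e) t) (fun _ => rfl)
      (fun e t => List.map_congr_left fun _ _ => decide_eq_decide.2 Iff.rfl) ?_
    obtain ⟨P, hP⟩ := hM.bound
    refine ⟨P, fun e B he t ht => ?_⟩
    cases t with
    | zero => simp [reachBits]
    | succ t => simpa [reachBits] using hP e B he
  exact (hv.getElem_eq_true h3).of_iff fun e => (reachBits_getElem ..).symm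

/-! ### Ancestors and runs -/

namespace LayeredAutomaton

variable {Q S : Type*} (A : LayeredAutomaton Q S)

theorem le_layer_of_ancestor {x : ℕ} {q p : Q} (h : A.ancestor x q = some p) :
    x ≤ A.layer q := by
  by_contra hx
  simp [ancestor, hx] at h

theorem one_le_of_ancestor {x : ℕ} {q p : Q} (h : A.ancestor x q = some p) : 1 ≤ x :=
  A.ancestor_layer h ▸ A.one_le_layer p

theorem ancestor_ancestor {x y : ℕ} {q p : Q} (h : A.ancestor x q = some p) (hy : y ≤ x) :
    A.ancestor y q = A.ancestor y p := by
  induction hn : A.layer q generalizing q with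
  | zero => have := A.one_le_layer q; omega
  | succ n ih =>
    have hx := A.le_layer_of_ancestor h
    rcases Nat.eq_or_lt_of_le hx with hx' | hx'
    · rw [hx', A.ancestor_self] at h
      rw [Option.some.inj h]
    · have := A.one_le_of_ancestor h
      cases hp : A.parent q with
      | none =>
        have := (A.parent_eq_none_iff q).1 hp
        omega
      | some r =>
        have h1 := A.layer_parent q r hp
        rw [A.ancestor_of_parent hp (by omega)] at h ⊢
        exact ih h (by omega)

theorem exists_ancestor {x : ℕ} {q : Q} (h1 : 1 ≤ x) (hx : x ≤ A.layer q) :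
    ∃ p, A.ancestor x q = some p := by
  induction hn : A.layer q generalizing q with
  | zero => have := A.one_le_layer q; omega
  | succ n ih =>
    rcases Nat.eq_or_lt_of_le hx with hx' | hx'
    · exact ⟨q, by rw [hx', A.ancestor_self]⟩
    · cases hp : A.parent q with
      | none =>
        have := (A.parent_eq_none_iff q).1 hp
        omega
      | some r =>
        have h2 := A.layer_parent q r hp
        rw [A.ancestor_of_parent hp (by omega)]
        exact ih (by omega) (by omega)

theorem exists_parent {q : Q} (h : 1 < A.layer q) : ∃ p, A.parent q = some p := by
  cases hp : A.parent q with
  | none =>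
    have := (A.parent_eq_none_iff q).1 hp
    omega
  | some r => exact ⟨r, rfl⟩

theorem ancestor_parent {q c : Q} {x : ℕ} (hx : 1 ≤ x) (h : A.ancestor (x + 1) q = some c) :
    ∃ p, A.parent c = some p ∧ A.ancestor x q = some p := by
  have hl := A.ancestor_layer h
  obtain ⟨p, hp⟩ := A.exists_parent (q := c) (by omega)
  have := A.layer_parent c p hp
  have hlp : A.layer p = x := by omega
  refine ⟨p, hp, ?_⟩
  rw [A.ancestor_ancestor h (Nat.le_succ x), A.ancestor_of_parent hp hlp.ge, ← hlp,
    A.ancestor_self]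

/-- Composites of the morphisms are again morphisms. -/
theorem step_ancestor {q q' p : Q} {a : S} {x : ℕ} (h : A.step q a = some q')
    (hp : A.ancestor x q = some p) :
    ∃ p', A.step p a = some p' ∧ A.ancestor x q' = some p' := by
  induction hn : A.layer q generalizing q q' with
  | zero => have := A.one_le_layer q; omega
  | succ n ih =>
    have hl := A.layer_step _ _ _ h
    have hx := A.le_layer_of_ancestor hp
    rcases Nat.eq_or_lt_of_le hx with hx' | hx'
    · rw [hx', A.ancestor_self] at hp
      exact ⟨q', Option.some.inj hp ▸ h, by rw [hx', ← hl, A.ancestor_self]⟩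
    · have := A.one_le_of_ancestor hp
      obtain ⟨r, hr⟩ := A.exists_parent (q := q) (by omega)
      obtain ⟨r', hr'⟩ := A.exists_parent (q := q') (by omega)
      have h1 := A.layer_parent _ _ hr
      have h2 := A.layer_parent _ _ hr'
      rw [A.ancestor_of_parent hr (by omega)] at hp
      rw [A.ancestor_of_parent hr' (by omega)]
      exact ih (A.parent_step _ _ _ _ _ h hr hr') hp (by omega)

theorem run_add (q : Q) (w : ℕ → S) (n m : ℕ) :
    A.run q w (n + m) = (A.run q w n).bind fun p => A.run p (fun i => w (n + i)) m := by
  induction m with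
  | zero => cases A.run q w n <;> rfl
  | succ m ih =>
    rw [← add_assoc, run, ih, Option.bind_assoc]
    rfl

theorem run_add_of_run {q p : Q} {w : ℕ → S} {n : ℕ} (h : A.run q w n = some p) (m : ℕ) :
    A.run q w (n + m) = A.run p (fun i => w (n + i)) m := by
  rw [run_add, h, Option.bind_some]

theorem layer_run {q p : Q} {w : ℕ → S} {n : ℕ} (h : A.run q w n = some p) :
    A.layer p = A.layer q := by
  induction n generalizing p with
  | zero => rw [← Option.some.inj h]
  | succ n ih =>
    rw [run, Option.bind_eq_some_iff] at h
    obtain ⟨r, hr, h⟩ := h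
    rw [A.layer_step _ _ _ h, ih hr]

theorem run_ancestor {q q' p : Q} {w : ℕ → S} {n x : ℕ} (h : A.run q w n = some q')
    (hp : A.ancestor x q = some p) :
    ∃ p', A.run p w n = some p' ∧ A.ancestor x q' = some p' := by
  induction n generalizing q' with
  | zero => exact ⟨p, rfl, Option.some.inj h ▸ hp⟩
  | succ n ih =>
    rw [run, Option.bind_eq_some_iff] at h
    obtain ⟨r, hr, h⟩ := h
    obtain ⟨r', h1, h2⟩ := ih hr
    obtain ⟨s, h3, h4⟩ := A.step_ancestor h h2
    exact ⟨s, by rw [run, h1, Option.bind_some, h3], h4⟩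

theorem exists_run_of_layer_one {q : Q} (h : A.layer q = 1) (w : ℕ → S) (n : ℕ) :
    ∃ p, A.run q w n = some p := by
  induction n with
  | zero => exact ⟨q, rfl⟩
  | succ n ih =>
    obtain ⟨p, hp⟩ := ih
    obtain ⟨p', hp'⟩ := A.step_complete p (w n) ((A.layer_run hp).trans h)
    exact ⟨p', by rw [run, hp, Option.bind_some, hp']⟩

theorem Safe.exists_run {q : Q} {w : ℕ → S} (h : A.Safe q w) (n : ℕ) :
    ∃ p, A.run q w n = some p :=
  Option.isSome_iff_exists.1 (h n)

theorem Safe.drop {q p : Q} {w : ℕ → S} {n : ℕ} (h : A.Safe q w) (hp : A.run q w n = some p) :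
    A.Safe p fun i => w (n + i) := fun m => by
  rw [← A.run_add_of_run hp]
  exact h _

/-- A safe child met after `m` letters of the suffix is one met after `n + m` letters of the word.
-/
theorem StronglySafe.drop {q p : Q} {w : ℕ → S} {n : ℕ} (h : A.StronglySafe q w)
    (hp : A.run q w n = some p) : A.StronglySafe p fun i => w (n + i) := by
  refine ⟨Safe.drop A h.1 hp, ?_⟩
  rintro ⟨m, r, p', h1, h2, h3⟩
  refine h.2 ⟨n + m, r, p', by rw [A.run_add_of_run hp, h1], h2, ?_⟩
  simpa only [add_assoc] using h3

/-- Some suffix of `w` is strongly safe from a state of a layer whose number satisfies `P`, where the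
run of `w` on the first layer visits the ancestor of that state. -/
def EventuallyStronglySafe (P : ℕ → Prop) (w : ℕ → S) : Prop :=
  ∃ n p, A.ancestor 1 p = A.run A.init w n ∧ P (A.layer p) ∧ A.StronglySafe p fun i => w (n + i)

-- Strong safety passes to suffixes along the run. Two witnesses found at different positions can
-- therefore be compared at a common one.
variable {A} in
theorem EventuallyStronglySafe.exists_ge {P : ℕ → Prop} {w : ℕ → S}
    (h : A.EventuallyStronglySafe P w) : ∃ n, ∀ m ≥ n, ∃ p, A.ancestor 1 p = A.run A.init w m ∧
      P (A.layer p) ∧ A.StronglySafe p fun i => w (m + i) := by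
  obtain ⟨n, p, h1, h2, h3⟩ := h
  refine ⟨n, fun m hm => ?_⟩
  obtain ⟨k, rfl⟩ := Nat.exists_eq_add_of_le hm
  obtain ⟨p', hp'⟩ := Safe.exists_run A h3.1 k
  obtain ⟨r, hr⟩ := A.exists_run_of_layer_one A.layer_init w n
  obtain ⟨r', h4, h5⟩ := A.run_ancestor hp' (h1.trans hr)
  refine ⟨p', by rw [h5, A.run_add_of_run hr, h4], A.layer_run hp' ▸ h2, ?_⟩
  simpa only [add_assoc] using StronglySafe.drop A h3 hp'

variable {A} in
theorem Consistent.not_even_and_odd (hA : A.Consistent) {w : ℕ → S}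
    (he : A.EventuallyStronglySafe Even w) (ho : A.EventuallyStronglySafe Odd w) : False := by
  obtain ⟨n, hn⟩ := he.exists_ge
  obtain ⟨m, hm⟩ := ho.exists_ge
  obtain ⟨p, h1, h2⟩ := hn (max n m) (le_max_left ..)
  obtain ⟨p', h3, h4⟩ := hm (max n m) (le_max_right ..)
  exact hA ⟨p, p', _, h1.trans h3.symm, h2, h4⟩

/-! ### The acceptance game -/

theorem le_actionLayer {q p p' : Q} {a : S} {x : ℕ} (h : A.ancestor x q = some p)
    (hp : A.step p a = some p') : x ≤ A.actionLayer q a :=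
  Nat.le_findGreatest (A.le_layer_of_ancestor h) (by simp [stepAt, h, hp])

theorem actionLayer_le_depth (q : Q) (a : S) : A.actionLayer q a ≤ A.depth :=
  (Nat.findGreatest_le _).trans (A.layer_le_depth q)

variable {A}

/-- The morphisms carry the transition on the layer of the priority to all lower layers, so up to
that layer the game is deterministic. The choice of the leaf affects higher layers only. -/
theorem trans_ancestor {q₀ : A.InitialLeaf} {q q' : A.Leaf} {a : S}
    (h : (A.sem q₀).trans q a q') {y : ℕ} (hy : y ≤ A.actionLayer q.1 a) {p : Q}
    (hp : A.ancestor y q.1 = some p) :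
    ∃ p', A.step p a = some p' ∧ A.ancestor y q'.1 = some p' := by
  obtain ⟨r', h1, h2⟩ := h
  rw [stepAt, Option.bind_eq_some_iff] at h1
  obtain ⟨r, h3, h4⟩ := h1
  rw [A.ancestor_ancestor h3 hy] at hp
  obtain ⟨p', h5, h6⟩ := A.step_ancestor h4 hp
  exact ⟨p', h5, by rw [A.ancestor_ancestor h2 hy, h6]⟩

/-- While the priorities are at least `y`, the ancestors on layer `y` form a run. -/
theorem ancestor_isRun {q₀ : A.InitialLeaf} {w : ℕ → S} {r : ℕ → A.Leaf}
    (hr : (A.sem q₀).IsRun w r) {m y : ℕ} {p : Q} (hp : A.ancestor y (r m).1 = some p) (j : ℕ)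
    (hy : ∀ i < j, y ≤ A.actionLayer (r (m + i)).1 (w (m + i))) :
    ∃ p', A.run p (fun i => w (m + i)) j = some p' ∧ A.ancestor y (r (m + j)).1 = some p' := by
  induction j with
  | zero => exact ⟨p, rfl, hp⟩
  | succ j ih =>
    obtain ⟨p', h1, h2⟩ := ih fun i hi => hy i (hi.trans (Nat.lt_succ_self j))
    obtain ⟨p'', h3, h4⟩ := trans_ancestor (hr.2 (m + j)) (hy j (Nat.lt_succ_self j)) h2
    exact ⟨p'', by rw [run, h1, Option.bind_some, h3], h4⟩

theorem one_le_actionLayer (q : Q) (a : S) : 1 ≤ A.actionLayer q a := by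
  obtain ⟨r, hr, hl⟩ := A.exists_ancestor_one q
  obtain ⟨r', hr'⟩ := A.step_complete r a hl
  exact A.le_actionLayer hr hr'

theorem ancestor_one_isRun {q₀ : A.InitialLeaf} {w : ℕ → S} {r : ℕ → A.Leaf}
    (hr : (A.sem q₀).IsRun w r) (n : ℕ) : A.ancestor 1 (r n).1 = A.run A.init w n := by
  have h0 : A.ancestor 1 (r 0).1 = some A.init := hr.1 ▸ q₀.2
  obtain ⟨p, h1, h2⟩ := ancestor_isRun hr h0 n fun i _ => one_le_actionLayer _ _
  simp only [zero_add] at h1 h2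
  rw [h1, h2]

/-- At `q`, moving with the letter `a` to `q'` is good in view of the remaining word `w`: if on the
layer above the priority there is a state with which `w` is safe, such a state is chosen. -/
def GoodMove (q : A.Leaf) (a : S) (w : ℕ → S) (q' : A.Leaf) : Prop :=
  ∀ p c, A.stepAt (A.actionLayer q.1 a) q.1 a = some p → A.parent c = some p → A.Safe c w →
    ∃ c', A.ancestor (A.actionLayer q.1 a + 1) q'.1 = some c' ∧ A.Safe c' w

theorem exists_goodMove (q₀ : A.InitialLeaf) (q : A.Leaf) (a : S) (w : ℕ → S) :
    ∃ q', (A.sem q₀).trans q a q' ∧ GoodMove q a w q' := by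
  by_cases h : ∃ p c, A.stepAt (A.actionLayer q.1 a) q.1 a = some p ∧ A.parent c = some p ∧
    A.Safe c w
  · obtain ⟨p, c, h1, h2, h3⟩ := h
    obtain ⟨q', hq'⟩ := A.exists_leaf_below c
    have hl := A.layer_parent _ _ h2
    have hlp : A.layer p = A.actionLayer q.1 a := by
      have h1' := h1
      rw [stepAt, Option.bind_eq_some_iff] at h1'
      obtain ⟨s, hs, hsp⟩ := h1'
      rw [A.layer_step s a p hsp, A.ancestor_layer hs]
    refine ⟨q', ⟨p, h1, ?_⟩, fun _ _ _ _ _ => ⟨c, ?_, h3⟩⟩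
    · rw [hq' _ (by omega), A.ancestor_of_parent h2 hlp.ge, ← hlp, A.ancestor_self]
    · rw [← hlp, ← hl, hq' _ le_rfl, A.ancestor_self]
  · obtain ⟨q', h'⟩ := A.sem_complete q a
    exact ⟨q', h', fun p c h1 h2 h3 => absurd ⟨p, c, h1, h2, h3⟩ h⟩

open Filter in
/-- If all moves of priority `y`, the least priority that occurs infinitely often, are good, then
a suffix of the word is strongly safe from a state on layer `y`. -/
theorem eventuallyStronglySafe_of_goodMove {q₀ : A.InitialLeaf} {w : ℕ → S} {r : ℕ → A.Leaf}
    (hr : (A.sem q₀).IsRun w r) {y : ℕ} (hinf : ∃ᶠ i in atTop, A.actionLayer (r i).1 (w i) = y)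
    (hge : ∀ᶠ i in atTop, y ≤ A.actionLayer (r i).1 (w i))
    (hgood : ∀ i, A.actionLayer (r i).1 (w i) = y →
      GoodMove (r i) (w i) (fun j => w (i + 1 + j)) (r (i + 1))) :
    A.EventuallyStronglySafe (· = y) w := by
  obtain ⟨m₀, hm₀⟩ := eventually_atTop.1 hge
  obtain ⟨m, hm, hmy⟩ := frequently_atTop.1 hinf m₀
  have hge' : ∀ i, y ≤ A.actionLayer (r (m + i)).1 (w (m + i)) := fun i => hm₀ _ (by omega)
  have hy1 : 1 ≤ y := hmy ▸ one_le_actionLayer _ _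
  obtain ⟨p, hp⟩ := A.exists_ancestor hy1
    (hmy ▸ Nat.findGreatest_le _ : y ≤ A.layer (r m).1)
  have hrun := fun j => ancestor_isRun hr hp j fun i _ => hge' i
  refine ⟨m, p, ?_, A.ancestor_layer hp, fun j => ?_, ?_⟩
  · rw [← ancestor_one_isRun hr, A.ancestor_ancestor hp hy1]
  · obtain ⟨p', h1, -⟩ := hrun j
    simp [h1]
  -- Suppose that a child `c` of a visited state is safe. It is followed up to the next move of
  -- priority `y`, where it shows that a good move has to go below a safe child.
  rintro ⟨n, s, c, hs, hc, hsafe⟩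
  obtain ⟨i, hi, hiy⟩ := frequently_atTop.1 hinf (m + n)
  obtain ⟨k, rfl⟩ := Nat.exists_eq_add_of_le hi
  -- One letter more than `k`, since `GoodMove` speaks of the children of the state reached by the
  -- move.
  obtain ⟨c₁, hc₁⟩ := Safe.exists_run A hsafe (k + 1)
  have hlc := A.layer_parent _ _ hc
  have hls : A.layer s = y := (A.layer_run hs).trans (A.ancestor_layer hp)
  have hcs : A.ancestor y c = some s := by
    rw [A.ancestor_of_parent hc hls.ge, ← hls, A.ancestor_self]
  obtain ⟨s₁, h1, h2⟩ := A.run_ancestor hc₁ hcs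
  have hl₁ : A.layer c₁ = y + 1 := by rw [A.layer_run hc₁, hlc, hls]
  obtain ⟨s₂, h3, h4⟩ := A.ancestor_parent hy1 (by rw [← hl₁, A.ancestor_self] :
    A.ancestor (y + 1) c₁ = some c₁)
  obtain rfl : s₁ = s₂ := Option.some.inj (h2.symm.trans h4)
  obtain ⟨t, h5, h6⟩ := hrun (n + k)
  have hst : A.stepAt y (r (m + n + k)).1 (w (m + n + k)) = some s₁ := by
    rw [add_assoc, stepAt, h6, Option.bind_some]
    have h7 := A.run_add_of_run hs (k + 1)
    simp only [← add_assoc] at h1 h7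
    rw [h1, run, ← add_assoc] at h7
    rw [h5, Option.bind_some] at h7
    simpa only [add_assoc] using h7
  obtain ⟨c', h8, h9⟩ := hgood _ hiy s₁ c₁ (by rw [hiy]; exact hst) h3 (by
    have := Safe.drop A hsafe hc₁
    simpa only [add_assoc] using this)
  rw [hiy] at h8
  -- As `c'` is safe, layer `y + 1` always has a transition from now on. Hence the priority never
  -- drops to `y` again, although `y` occurs infinitely often.
  have hup : ∀ j, ∃ c'', A.run c' (fun i => w (m + n + k + 1 + i)) j = some c'' ∧
      A.ancestor (y + 1) (r (m + n + k + 1 + j)).1 = some c'' := by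
    intro j
    induction j using Nat.strong_induction_on with
    | _ j ih =>
      refine ancestor_isRun hr h8 j fun i hi => ?_
      obtain ⟨c'', h10, h11⟩ := ih i hi
      obtain ⟨c''', h12⟩ := Safe.exists_run A h9 (i + 1)
      rw [run, h10, Option.bind_some] at h12
      exact A.le_actionLayer h11 h12
  obtain ⟨i, hi, hiy'⟩ := frequently_atTop.1 hinf (m + n + k + 1)
  obtain ⟨j, rfl⟩ := Nat.exists_eq_add_of_le hi
  obtain ⟨c₂, h10, h11⟩ := hup j
  obtain ⟨c₃, h12⟩ := Safe.exists_run A h9 (j + 1)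
  rw [run, h10, Option.bind_some] at h12
  have := A.le_actionLayer h11 h12
  omega

open Filter in
theorem _root_.exists_frequently_eq_and_eventually_le {c : ℕ → ℕ} {d : ℕ} (h : ∀ i, c i ≤ d) :
    ∃ y, (∃ᶠ i in atTop, c i = y) ∧ ∀ᶠ i in atTop, y ≤ c i := by
  classical
  have hex : ∃ y, ∃ᶠ i in atTop, c i = y := by
    by_contra hn
    push Not at hn
    have h1 : ∀ᶠ i in atTop, ∀ y ∈ Finset.range (d + 1), c i ≠ y :=
      (Filter.eventually_all_finset _).2 fun y _ => hn y
    obtain ⟨i, hi⟩ := h1.exists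
    exact hi (c i) (Finset.mem_range.2 (Nat.lt_succ_of_le (h i))) rfl
  refine ⟨Nat.find hex, Nat.find_spec hex, ?_⟩
  have h2 : ∀ᶠ i in atTop, ∀ y ∈ Finset.range (Nat.find hex), c i ≠ y :=
    (Filter.eventually_all_finset _).2 fun y hy =>
      not_frequently.1 (Nat.find_min hex (Finset.mem_range.1 hy))
  filter_upwards [h2] with i hi
  by_contra hlt
  exact hi (c i) (Finset.mem_range.2 (not_le.1 hlt)) rfl

/-- In each round, some good move is available. -/
theorem exists_goodStrategy (q₀ : A.InitialLeaf) (w : ℕ → S) :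
    ∃ b : ℕ → A.Leaf → A.Leaf, ∀ i q, (A.sem q₀).trans q (w i) (b i q) ∧
      GoodMove q (w i) (fun j => w (i + 1 + j)) (b i q) := by
  choose b hb using fun i q => exists_goodMove q₀ q (w i) fun j => w (i + 1 + j)
  exact ⟨b, hb⟩

/-- In a play in which both players make good moves, the least priority seen infinitely often gives
a witness of its parity. Consistency plays no role. -/
theorem eventuallyStronglySafe_even_or_odd (A : LayeredAutomaton Q S) (w : ℕ → S) :
    A.EventuallyStronglySafe Even w ∨ A.EventuallyStronglySafe Odd w := by
  obtain ⟨q₀⟩ := A.exists_initialLeaf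
  obtain ⟨b, hb⟩ := exists_goodStrategy q₀ w
  set r : ℕ → A.Leaf := fun n => Nat.rec q₀.1 (fun i q => b i q) n
  obtain ⟨y, hy, hy'⟩ := exists_frequently_eq_and_eventually_le
    fun i => A.actionLayer_le_depth (r i).1 (w i)
  obtain ⟨n, p, h1, h2, h3⟩ := eventuallyStronglySafe_of_goodMove (q₀ := q₀) (r := r)
    ⟨rfl, fun i => (hb i (r i)).1⟩ hy hy' fun i _ => (hb i (r i)).2
  rcases Nat.even_or_odd (A.layer p) with h | h
  · exact Or.inl ⟨n, p, h1, h, h3⟩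
  · exact Or.inr ⟨n, p, h1, h, h3⟩

/-- The language of a consistent layered automaton consists of the words that are eventually
strongly accepted. -/
theorem mem_language_iff (hA : A.Consistent) (q₀ : A.InitialLeaf) (w : ℕ → S) :
    w ∈ (A.sem q₀).language ↔ A.EventuallyStronglySafe Even w := by
  obtain ⟨b, hb⟩ := exists_goodStrategy q₀ w
  constructor
  · rintro ⟨σ, hσ, hwin⟩
    classical
    -- Eve's winning strategy is played against good moves of Adam. The history is carried along
    -- because her strategy may depend on it.
    let next : List A.Leaf × A.Leaf → List A.Leaf × A.Leaf := fun s =>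
      (s.1 ++ [s.2], if Odd (A.actionLayer s.2.1 (w s.1.length)) then σ s.1 s.2
        else b s.1.length s.2)
    let s : ℕ → List A.Leaf × A.Leaf := fun n => next^[n] ([], q₀.1)
    have hs : ∀ n, s (n + 1) = next (s n) := fun n => Function.iterate_succ_apply' ..
    let r : ℕ → A.Leaf := fun n => (s n).2
    have hh : ∀ n, (s n).1 = (List.range n).map r := by
      intro n
      induction n with
      | zero => rfl
      | succ n ih =>
        rw [hs, List.range_succ, List.map_append, ← ih]
        rfl
    have hr : ∀ n, r (n + 1) = if Odd (A.actionLayer (r n).1 (w n))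
        then σ ((List.range n).map r) (r n) else b n (r n) := by
      intro n
      change (s (n + 1)).2 = _
      rw [hs]
      simp only [next, hh, List.length_map, List.length_range]
      rfl
    have hrun : (A.sem q₀).IsRun w r := by
      refine ⟨rfl, fun i => ?_⟩
      rw [hr]
      split_ifs with h
      · have := hσ ((List.range i).map r) (r i)
        simp only [List.length_map, List.length_range] at this
        exact this h
      · exact (hb i (r i)).1
    obtain ⟨y, hy, hy1, hy2⟩ := hwin r hrun fun i hi => (hr i).trans (if_pos hi)
    obtain ⟨n, p, h1, h2, h3⟩ := eventuallyStronglySafe_of_goodMove hrun hy1 hy2 fun i hi => by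
      rw [hr, if_neg (by rw [hi]; exact Nat.not_odd_iff_even.2 hy)]
      exact (hb i (r i)).2
    exact ⟨n, p, h1, h2.symm ▸ hy, h3⟩
  · intro hw
    -- Eve makes good moves, which depend on the round and the current leaf only. If the least
    -- recurring priority were odd, all moves of that priority would be hers, and the resulting odd
    -- witness would contradict consistency.
    refine ⟨fun h q => b h.length q, fun h q _ => (hb _ q).1, fun r hr hf => ?_⟩
    obtain ⟨y, hy, hy'⟩ := exists_frequently_eq_and_eventually_le
      fun i => A.actionLayer_le_depth (r i).1 (w i)
    refine ⟨y, ?_, hy, hy'⟩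
    by_contra hodd
    rw [Nat.not_even_iff_odd] at hodd
    obtain ⟨n, p, h1, h2, h3⟩ := eventuallyStronglySafe_of_goodMove hr hy hy' fun i hi => by
      rw [hf i (show Odd (A.actionLayer (r i).1 (w i)) from hi.symm ▸ hodd)]
      simp only [List.length_map, List.length_range]
      exact (hb i (r i)).2
    exact hA.not_even_and_odd hw ⟨n, p, h1, h2.symm ▸ hodd, h3⟩

theorem notMem_language_iff (hA : A.Consistent) (q₀ : A.InitialLeaf) (w : ℕ → S) :
    w ∉ (A.sem q₀).language ↔ A.EventuallyStronglySafe Odd w := by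
  rw [mem_language_iff hA]
  exact ⟨fun h => (A.eventuallyStronglySafe_even_or_odd w).resolve_left h,
    fun h h' => hA.not_even_and_odd h' h⟩

end LayeredAutomaton

/-! ### Children along runs -/

namespace LayeredAutomaton

open Relation

variable {Q Q' S : Type*} (A : LayeredAutomaton Q S) (A' : LayeredAutomaton Q' S)

theorem step_parent {q q' p p' : Q} {a : S} (h : A.step q a = some q') (hp : A.parent q = some p)
    (h' : A.step p a = some p') : A.parent q' = some p' := by
  have h1 := A.layer_parent _ _ hp
  have h2 := A.layer_step _ _ _ h
  have h3 := A.one_le_layer p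
  obtain ⟨r, hr⟩ := A.exists_parent (q := q') (by omega)
  rw [hr, ← h', A.parent_step _ _ _ _ _ h hp hr]

theorem run_parent {q q' p p' : Q} {w : ℕ → S} {n : ℕ} (h : A.run q w n = some q')
    (hp : A.parent q = some p) (h' : A.run p w n = some p') : A.parent q' = some p' := by
  induction n generalizing q' p' with
  | zero => rw [← Option.some.inj h, ← Option.some.inj h', hp]
  | succ n ih =>
    rw [run, Option.bind_eq_some_iff] at h h'
    obtain ⟨r, hr, h⟩ := h
    obtain ⟨r', hr', h'⟩ := h'
    exact A.step_parent h (ih hr hr') h'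

theorem run_eq_none_of_le {q : Q} {w : ℕ → S} {m n : ℕ} (h : A.run q w m = none) (hmn : m ≤ n) :
    A.run q w n = none := by
  obtain ⟨k, rfl⟩ := Nat.exists_eq_add_of_le hmn
  rw [run_add, h, Option.bind_none]

/-! ### The product of two automata, with an additional state that may get stuck -/

/-- The effect of a letter on a state of one of the automata, or on the stuck state `none`. -/
def tokenStep (a : S) : Option (Q ⊕ Q') → Option (Q ⊕ Q')
  | none => none
  | some (.inl c) => (A.step c a).map Sum.inl
  | some (.inr c) => (A'.step c a).map Sum.inr

/-- The transitions of the product of `A`, `A'` and an additional state that may get stuck. -/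
def ProductEdge (x y : Q × Q' × Option (Q ⊕ Q')) : Prop :=
  ∃ a, A.step x.1 a = some y.1 ∧ A'.step x.2.1 a = some y.2.1 ∧
    y.2.2 = tokenStep A A' a x.2.2

/-- A witness for the non-inclusion of the languages: a pair of states, on an even and an odd layer,
over a reachable pair of states of the first layers, with cycles on which any child of the two
states gets stuck. -/
def NonInclusionWitness (p : Q) (p' : Q') : Prop :=
  Even (A.layer p) ∧ Odd (A'.layer p') ∧
  (∃ r r', A.ancestor 1 p = some r ∧ A'.ancestor 1 p' = some r' ∧
    ReflTransGen (ProductEdge A A') (A.init, A'.init, none) (r, r', none)) ∧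
  TransGen (ProductEdge A A') (p, p', none) (p, p', none) ∧
  (∀ c, A.parent c = some p → TransGen (ProductEdge A A') (p, p', some (.inl c)) (p, p', none)) ∧
  ∀ c, A'.parent c = some p' → TransGen (ProductEdge A A') (p, p', some (.inr c)) (p, p', none)

theorem transGen_of_forall_succ {α : Type*} {r : α → α → Prop} {X : ℕ → α}
    (h : ∀ i, r (X i) (X (i + 1))) {n : ℕ} (hn : 0 < n) : TransGen r (X 0) (X n) := by
  induction n with
  | zero => omega
  | succ n ih =>
    rcases Nat.eq_zero_or_pos n with rfl | hn
    · exact .single (h 0)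
    · exact (ih hn).tail (h n)

/-- Some pair of states recurs infinitely often along the two strongly safe runs. From one
occurrence on, every child of the pair gets stuck by strong safety, and a later occurrence of the
pair closes the cycle. -/
theorem exists_nonInclusionWitness [Finite Q] [Finite Q'] {w : ℕ → S}
    (h : A.EventuallyStronglySafe Even w) (h' : A'.EventuallyStronglySafe Odd w) :
    ∃ p p', NonInclusionWitness A A' p p' := by
  obtain ⟨n₁, hn₁⟩ := h.exists_ge
  obtain ⟨n₂, hn₂⟩ := h'.exists_ge
  obtain ⟨p, h1, h2, h3⟩ := hn₁ (max n₁ n₂) (le_max_left ..)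
  obtain ⟨p', h1', h2', h3'⟩ := hn₂ (max n₁ n₂) (le_max_right ..)
  generalize max n₁ n₂ = n at h1 h3 h1' h3'
  choose R hR using fun i => Safe.exists_run A h3.1 i
  choose R' hR' using fun i => Safe.exists_run A' h3'.1 i
  obtain ⟨s, hs⟩ := Finite.exists_infinite_fiber fun i => (R i, R' i)
  have hinf : ∀ m, ∃ i > m, R i = s.1 ∧ R' i = s.2 := by
    intro m
    obtain ⟨i, hi, hmi⟩ := (Set.infinite_coe_iff.1 hs).exists_gt m
    rw [Set.mem_preimage, Set.mem_singleton_iff] at hi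
    exact ⟨i, hmi, by rw [← hi], by rw [← hi]⟩
  obtain ⟨m, -, hm, hm'⟩ := hinf 0
  have hs1 := StronglySafe.drop A h3 (hm ▸ hR m)
  have hs2 := StronglySafe.drop A' h3' (hm' ▸ hR' m)
  simp only [← add_assoc] at hs1 hs2
  obtain ⟨r, hr⟩ := A.exists_run_of_layer_one A.layer_init w n
  obtain ⟨r', hr'⟩ := A'.exists_run_of_layer_one A'.layer_init w n
  obtain ⟨t, ht1, ht2⟩ := A.run_ancestor (hm ▸ hR m) (h1.trans hr)
  obtain ⟨t', ht1', ht2'⟩ := A'.run_ancestor (hm' ▸ hR' m) (h1'.trans hr')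
  rw [← A.run_add_of_run hr] at ht1
  rw [← A'.run_add_of_run hr'] at ht1'
  have hstep : ∀ i, A.step (R (m + i)) (w (n + m + i)) = some (R (m + (i + 1))) := by
    intro i
    have := hR (m + i + 1)
    rwa [run, hR, Option.bind_some, ← add_assoc] at this
  have hstep' : ∀ i, A'.step (R' (m + i)) (w (n + m + i)) = some (R' (m + (i + 1))) := by
    intro i
    have := hR' (m + i + 1)
    rwa [run, hR', Option.bind_some, ← add_assoc] at this
  generalize n + m = k at hs1 hs2 ht1 ht1' hstep hstep'
  have hreach : ∀ i, ∃ u u', A.run A.init w i = some u ∧ A'.run A'.init w i = some u' ∧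
      ReflTransGen (ProductEdge A A') (A.init, A'.init, none) (u, u', none) := by
    intro i
    induction i with
    | zero => exact ⟨_, _, rfl, rfl, .refl⟩
    | succ i ih =>
      obtain ⟨u, u', e1, e2, e3⟩ := ih
      obtain ⟨v, hv⟩ := A.exists_run_of_layer_one A.layer_init w (i + 1)
      obtain ⟨v', hv'⟩ := A'.exists_run_of_layer_one A'.layer_init w (i + 1)
      refine ⟨v, v', hv, hv', e3.tail ⟨w i, ?_, ?_, rfl⟩⟩
      · rwa [run, e1, Option.bind_some] at hv
      · rwa [run, e2, Option.bind_some] at hv'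
  obtain ⟨u, u', e1, e2, e3⟩ := hreach k
  rw [ht1] at e1
  rw [ht1'] at e2
  rw [← Option.some.inj e1, ← Option.some.inj e2] at e3
  -- `Z` is the trajectory of a token that is stuck from time `M` on. The pair is revisited more
  -- than `M` letters later, so the cycle is nonempty and ends with the token stuck.
  have hloop : ∀ (z : Option (Q ⊕ Q')) (Z : ℕ → Option (Q ⊕ Q')), Z 0 = z →
      (∀ i, Z (i + 1) = tokenStep A A' (w (k + i)) (Z i)) →
      (∃ m, ∀ i ≥ m, Z i = none) →
      TransGen (ProductEdge A A') (s.1, s.2, z) (s.1, s.2, none) := by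
    rintro z Z rfl hZ ⟨M, hM⟩
    obtain ⟨i, hi, hi1, hi2⟩ := hinf (m + M)
    obtain ⟨j, rfl⟩ := Nat.exists_eq_add_of_le (show m ≤ i by omega)
    have := transGen_of_forall_succ (r := ProductEdge A A')
      (X := fun i => (R (m + i), R' (m + i), Z i)) (fun i => ⟨_, hstep i, hstep' i, hZ i⟩)
      (show 0 < j by omega)
    simpa only [add_zero, hm, hm', hi1, hi2, hM j (by omega)] using this
  refine ⟨s.1, s.2, ?_, ?_, ⟨t, t', ht2, ht2', e3⟩, hloop none (fun _ => none) rfl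
    (fun _ => rfl) ⟨0, fun _ _ => rfl⟩, fun c hc => ?_, fun c hc => ?_⟩
  · rw [← hm, A.layer_run (hR m)]
    exact h2
  · rw [← hm', A'.layer_run (hR' m)]
    exact h2'
  · refine hloop _ (fun i => (A.run c (fun i => w (k + i)) i).map .inl) rfl (fun i => ?_) ?_
    · rw [run]
      cases A.run c (fun i => w (k + i)) i <;> rfl
    · by_contra hne
      refine hs1.2 ⟨0, s.1, c, rfl, hc, fun i => ?_⟩
      by_contra hi
      rw [Bool.not_eq_true, Option.isSome_eq_false_iff, Option.isNone_iff_eq_none] at hi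
      simp only [zero_add] at hi
      exact hne ⟨i, fun j hj => by rw [A.run_eq_none_of_le hi hj]; rfl⟩
  · refine hloop _ (fun i => (A'.run c (fun i => w (k + i)) i).map .inr) rfl (fun i => ?_) ?_
    · rw [run]
      cases A'.run c (fun i => w (k + i)) i <;> rfl
    · by_contra hne
      refine hs2.2 ⟨0, s.2, c, rfl, hc, fun i => ?_⟩
      by_contra hi
      rw [Bool.not_eq_true, Option.isSome_eq_false_iff, Option.isNone_iff_eq_none] at hi
      simp only [zero_add] at hi
      exact hne ⟨i, fun j hj => by rw [A'.run_eq_none_of_le hi hj]; rfl⟩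

/-! ### Runs over finite words -/

/-- The state reached over a finite word. -/
def runList (o : Option Q) (u : List S) : Option Q :=
  u.foldl (fun o a => o.bind fun q => A.step q a) o

theorem runList_append (o : Option Q) (u v : List S) :
    A.runList o (u ++ v) = A.runList (A.runList o u) v :=
  List.foldl_append

theorem runList_none (u : List S) : A.runList none u = none := by
  induction u with
  | nil => rfl
  | cons a u ih => exact ih

theorem run_length_eq_runList {q : Q} {w : ℕ → S} {u : List S}
    (h : ∀ i (hi : i < u.length), u[i] = w i) : A.run q w u.length = A.runList (some q) u := by
  induction u using List.reverseRecOn with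
  | nil => rfl
  | append_singleton u a ih =>
    have h1 := h u.length (by simp)
    rw [List.getElem_concat_length rfl] at h1
    rw [List.length_append, List.length_singleton, run, runList_append, ← ih, h1]
    · rfl
    · intro i hi
      rw [← h i (by simp; omega), List.getElem_append_left hi]

theorem runList_parent {q q' p p' : Q} {u : List S} (h : A.runList (some q) u = some q')
    (hp : A.parent q = some p) (h' : A.runList (some p) u = some p') : A.parent q' = some p' := by
  induction u generalizing q p with
  | nil => rw [← Option.some.inj h, ← Option.some.inj h', hp]
  | cons a u ih =>
    change A.runList (A.step q a) u = _ at h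
    change A.runList (A.step p a) u = _ at h'
    cases e : A.step q a with
    | none => rw [e, runList_none] at h; cases h
    | some r =>
      cases e' : A.step p a with
      | none => rw [e', runList_none] at h'; cases h'
      | some r' =>
        rw [e] at h
        rw [e'] at h'
        exact ih h (A.step_parent e hp e') h'

/-- The effect of a finite word on a state of one of the automata, or on the stuck state. -/
def tokenRun (z : Option (Q ⊕ Q')) (u : List S) : Option (Q ⊕ Q') :=
  u.foldl (fun z a => tokenStep A A' a z) z

theorem tokenRun_append (z : Option (Q ⊕ Q')) (u v : List S) :
    tokenRun A A' z (u ++ v) = tokenRun A A' (tokenRun A A' z u) v :=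
  List.foldl_append

theorem tokenRun_none (u : List S) : tokenRun A A' none u = none := by
  induction u with
  | nil => rfl
  | cons a u ih => exact ih

theorem tokenRun_inl (o : Option Q) (u : List S) :
    tokenRun A A' (o.map .inl) u = (A.runList o u).map .inl := by
  induction u generalizing o with
  | nil => rfl
  | cons a u ih =>
    cases o with
    | none => simpa [runList_none] using tokenRun_none A A' (a :: u)
    | some q => exact ih (A.step q a)

theorem tokenRun_inr (o : Option Q') (u : List S) :
    tokenRun A A' (o.map .inr) u = (A'.runList o u).map .inr := by
  induction u generalizing o with
  | nil => rfl
  | cons a u ih =>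
    cases o with
    | none => simpa [runList_none] using tokenRun_none A A' (a :: u)
    | some q => exact ih (A'.step q a)

theorem exists_word_of_reflTransGen {x y : Q × Q' × Option (Q ⊕ Q')}
    (h : ReflTransGen (ProductEdge A A') x y) : ∃ u : List S,
      A.runList (some x.1) u = some y.1 ∧ A'.runList (some x.2.1) u = some y.2.1 ∧
        tokenRun A A' x.2.2 u = y.2.2 := by
  induction h with
  | refl => exact ⟨[], rfl, rfl, rfl⟩
  | tail _ h ih =>
    obtain ⟨u, h1, h2, h3⟩ := ih
    obtain ⟨a, h4, h5, h6⟩ := h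
    refine ⟨u ++ [a], ?_, ?_, ?_⟩
    · rw [runList_append, h1]
      exact h4
    · rw [runList_append, h2]
      exact h5
    · rw [tokenRun_append, h3, h6]
      rfl

theorem exists_word_of_transGen {x y : Q × Q' × Option (Q ⊕ Q')}
    (h : TransGen (ProductEdge A A') x y) : ∃ u : List S, u ≠ [] ∧
      A.runList (some x.1) u = some y.1 ∧ A'.runList (some x.2.1) u = some y.2.1 ∧
        tokenRun A A' x.2.2 u = y.2.2 := by
  obtain ⟨z, h, a, h4, h5, h6⟩ := TransGen.tail'_iff.1 h
  obtain ⟨u, h1, h2, h3⟩ := exists_word_of_reflTransGen A A' h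
  refine ⟨u ++ [a], by simp, ?_, ?_, ?_⟩
  · rw [runList_append, h1]
    exact h4
  · rw [runList_append, h2]
    exact h5
  · rw [tokenRun_append, h3, h6]
    rfl

/-- A single cycle on which all children of the two states get stuck. -/
theorem NonInclusionWitness.exists_word [Finite Q] [Finite Q'] {p : Q} {p' : Q'}
    (h : NonInclusionWitness A A' p p') : ∃ u : List S, u ≠ [] ∧
      A.runList (some p) u = some p ∧ A'.runList (some p') u = some p' ∧
      (∀ c, A.parent c = some p → A.runList (some c) u = none) ∧
      ∀ c, A'.parent c = some p' → A'.runList (some c) u = none := by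
  obtain ⟨-, -, -, h0, h1, h2⟩ := h
  -- The possible tokens over `(p, p')`: each has a cycle that kills it (`hK1`), and every cycle
  -- maps `K` to itself because children are carried to children (`hK2`).
  set K : Set (Option (Q ⊕ Q')) := {z | z = none ∨ (∃ c, z = some (.inl c) ∧ A.parent c = some p) ∨
    ∃ c, z = some (.inr c) ∧ A'.parent c = some p'} with hK
  have hK1 : ∀ z ∈ K, ∃ u : List S, u ≠ [] ∧ A.runList (some p) u = some p ∧
      A'.runList (some p') u = some p' ∧ tokenRun A A' z u = none := by
    rintro z (rfl | ⟨c, rfl, hc⟩ | ⟨c, rfl, hc⟩)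
    · exact exists_word_of_transGen A A' h0
    · exact exists_word_of_transGen A A' (h1 c hc)
    · exact exists_word_of_transGen A A' (h2 c hc)
  have hK2 : ∀ z ∈ K, ∀ u, A.runList (some p) u = some p → A'.runList (some p') u = some p' →
      tokenRun A A' z u ∈ K := by
    rintro z (rfl | ⟨c, rfl, hc⟩ | ⟨c, rfl, hc⟩) u hu hu'
    · exact Or.inl (tokenRun_none A A' u)
    · rw [show some (Sum.inl c) = (some c).map (Sum.inl : Q → Q ⊕ Q') from rfl, tokenRun_inl]
      cases e : A.runList (some c) u with
      | none => exact Or.inl rfl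
      | some c' => exact Or.inr (Or.inl ⟨c', rfl, A.runList_parent e hc hu⟩)
    · rw [show some (Sum.inr c) = (some c).map (Sum.inr : Q' → Q ⊕ Q') from rfl, tokenRun_inr]
      cases e : A'.runList (some c) u with
      | none => exact Or.inl rfl
      | some c' => exact Or.inr (Or.inr ⟨c', rfl, A'.runList_parent e hc hu'⟩)
  -- Tokens are killed one after the other: once `u` has killed those in `C`, the image of the next
  -- token under `u` is again in `K`, and a cycle for this image is appended.
  have key : ∀ C : List (Option (Q ⊕ Q')), (∀ z ∈ C, z ∈ K) → ∃ u : List S, u ≠ [] ∧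
      A.runList (some p) u = some p ∧ A'.runList (some p') u = some p' ∧
      ∀ z ∈ C, tokenRun A A' z u = none := by
    intro C
    induction C with
    | nil =>
      intro _
      obtain ⟨u, e1, e2, e3, -⟩ := hK1 none (Or.inl rfl)
      exact ⟨u, e1, e2, e3, by simp⟩
    | cons z C ih =>
      intro hC
      obtain ⟨u, e1, e2, e3, e4⟩ := ih fun z hz => hC z (by simp [hz])
      obtain ⟨v, f1, f2, f3, f4⟩ := hK1 _ (hK2 z (hC z (by simp)) u e2 e3)
      refine ⟨u ++ v, by simp [e1], by rw [runList_append, e2, f2],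
        by rw [runList_append, e3, f3], fun y hy => ?_⟩
      rw [tokenRun_append]
      rcases List.mem_cons.1 hy with rfl | hy
      · exact f4
      · rw [e4 y hy, tokenRun_none]
  obtain ⟨u, e1, e2, e3, e4⟩ := key (Set.toFinite K).toFinset.toList (by simp)
  refine ⟨u, e1, e2, e3, fun c hc => ?_, fun c hc => ?_⟩
  · have := e4 ((some c).map .inl) (by simp [hK, hc])
    rwa [tokenRun_inl, Option.map_eq_none_iff] at this
  · have := e4 ((some c).map .inr) (by simp [hK, hc])
    rwa [tokenRun_inr, Option.map_eq_none_iff] at this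

/-- A child that is safe from position `n` on could be followed to position `n * u.length`, where
the run is back at `p`. There it is a child of `p`, and the next copy of `u` kills it. -/
theorem stronglySafe_periodic {p : Q} {u : List S} {w : ℕ → S} (hu : u ≠ [])
    (h : A.runList (some p) u = some p)
    (hc : ∀ c, A.parent c = some p → A.runList (some c) u = none)
    (hw : ∀ i (hi : i < u.length), u[i] = w i) (hper : ∀ i, w (u.length + i) = w i) :
    A.StronglySafe p w := by
  have hpos : 0 < u.length := List.length_pos_iff.2 hu
  have hshift : ∀ m, (fun i => w (m * u.length + i)) = w := by
    intro m
    induction m with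
    | zero => funext i; rw [zero_mul, zero_add]
    | succ m ih =>
      funext i
      rw [add_mul, one_mul, add_assoc]
      exact (congrFun ih (u.length + i)).trans (hper i)
  have hrun : ∀ m, A.run p w (m * u.length) = some p := by
    intro m
    induction m with
    | zero => rw [zero_mul]; rfl
    | succ m ih =>
      rw [add_mul, one_mul, A.run_add_of_run ih, hshift, A.run_length_eq_runList hw, h]
  refine ⟨fun n => ?_, ?_⟩
  · by_contra hn
    rw [Bool.not_eq_true, Option.isSome_eq_false_iff, Option.isNone_iff_eq_none] at hn
    have := A.run_eq_none_of_le hn (Nat.le_mul_of_pos_right n hpos)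
    rw [hrun] at this
    cases this
  · rintro ⟨n, r, c, h1, h2, h3⟩
    obtain ⟨k, hk⟩ := Nat.exists_eq_add_of_le (Nat.le_mul_of_pos_right n hpos)
    obtain ⟨c', hc'⟩ := Safe.exists_run A h3 k
    have h4 : A.run r (fun i => w (n + i)) k = some p := by
      rw [← A.run_add_of_run h1, ← hk, hrun]
    obtain ⟨c'', h5⟩ := Safe.exists_run A (Safe.drop A h3 hc') u.length
    simp only [← add_assoc, ← hk, hshift] at h5
    rw [A.run_length_eq_runList hw, hc c' (A.run_parent hc' h2 h4)] at h5
    cases h5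

/-- The word is `v` followed by `u` forever, where `u` is the cycle that kills all children. The
prefix `v` only has to lead to the ancestors of `p` and `p'` on the first layers. -/
theorem NonInclusionWitness.exists_infinite_word [Finite Q] [Finite Q'] {p : Q} {p' : Q'}
    (h : NonInclusionWitness A A' p p') :
    ∃ w : ℕ → S, A.EventuallyStronglySafe Even w ∧ A'.EventuallyStronglySafe Odd w := by
  obtain ⟨u, hu, h1, h2, h3, h4⟩ := h.exists_word
  obtain ⟨he, ho, ⟨r, r', hr, hr', hreach⟩, -⟩ := h
  obtain ⟨v, h5, h6, -⟩ := exists_word_of_reflTransGen A A' hreach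
  have hpos : 0 < u.length := List.length_pos_iff.2 hu
  set x : ℕ → S := fun i => u[i % u.length]'(Nat.mod_lt _ hpos) with hx
  have hx1 : ∀ i (hi : i < u.length), u[i] = x i := fun i hi => by
    simp only [hx, Nat.mod_eq_of_lt hi]
  have hx2 : ∀ i, x (u.length + i) = x i := fun i => by
    simp only [hx, Nat.add_mod_left]
  set w : ℕ → S := fun i => if h : i < v.length then v[i] else x (i - v.length) with hw
  have hw1 : ∀ i (hi : i < v.length), v[i] = w i := fun i hi => by simp [hw, hi]
  have hw2 : (fun i => w (v.length + i)) = x := by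
    funext i
    simp [hw]
  refine ⟨w, ⟨v.length, p, ?_, he, ?_⟩, ⟨v.length, p', ?_, ho, ?_⟩⟩
  · rw [hr, A.run_length_eq_runList hw1, h5]
  · rw [hw2]
    exact A.stronglySafe_periodic hu h1 h3 hx1 hx2
  · rw [hr', A'.run_length_eq_runList hw1, h6]
  · rw [hw2]
    exact A'.stronglySafe_periodic hu h2 h4 hx1 hx2

variable {A A'} in
/-- The inclusion of the languages of consistent automata in terms of finite paths. -/
theorem language_subset_iff [Finite Q] [Finite Q'] (hA : A.Consistent) (hA' : A'.Consistent)
    (q : A.InitialLeaf) (q' : A'.InitialLeaf) :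
    (A.sem q).language ⊆ (A'.sem q').language ↔ ¬ ∃ p p', NonInclusionWitness A A' p p' := by
  rw [← not_iff_not, not_not, Set.not_subset]
  constructor
  · rintro ⟨w, h, h'⟩
    exact exists_nonInclusionWitness A A' ((mem_language_iff hA q w).1 h)
      ((notMem_language_iff hA' q' w).1 h')
  · rintro ⟨p, p', h⟩
    obtain ⟨w, h1, h2⟩ := h.exists_infinite_word
    exact ⟨w, (mem_language_iff hA q w).2 h1, (notMem_language_iff hA' q' w).2 h2⟩

end LayeredAutomaton

/-! ### Deciding non-inclusion from the tables -/

/-- The successor table at position `b` of the input: `0` if undefined, and `i + 1` for the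
state `i`. -/
def tableStep (w : List Bool) (b q a : ℕ) : ℕ :=
  -- Three header numbers (size, depth, initial state) precede the rows. With `k` letters, stored at
  -- position `0`, a row has `k + 2` numbers: layer, parent and successors.
  nthNat w (b + 3 + q * (nthNat w 0 + 2) + 2 + a)

/-- The parent table at position `b` of the input. -/
def tableParent (w : List Bool) (b q : ℕ) : ℕ :=
  nthNat w (b + 3 + q * (nthNat w 0 + 2) + 1)

/-- The layer table at position `b` of the input. -/
def tableLayer (w : List Bool) (b q : ℕ) : ℕ :=
  nthNat w (b + 3 + q * (nthNat w 0 + 2))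

/-- The ancestor on the first layer. -/
def tableRoot (w : List Bool) (b q : ℕ) : ℕ :=
  -- A parent `i` is stored as `i + 1`.
  (fun x => tableParent w b x - 1)^[tableLayer w b q - 1] q

/-- The position of the table of the second automaton. -/
def secondTable (w : List Bool) : ℕ := 4 + nthNat w 1 * (nthNat w 0 + 2)

/-- The number of states of the first automaton. -/
def firstSize (w : List Bool) : ℕ := nthNat w 1

/-- The number of states of the second automaton. -/
def secondSize (w : List Bool) : ℕ := nthNat w (secondTable w)

/-- The code of a state of the product. -/
def productCode (w : List Bool) (p p' z : ℕ) : ℕ :=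
  p + firstSize w * (p' + secondSize w * z)

/-- The effect of a letter on the code of the additional state of the product. -/
def tokenTable (w : List Bool) (z a : ℕ) : ℕ :=
  if z = 0 then 0 else if z < firstSize w + 1 then tableStep w 1 (z - 1) a
  else if tableStep w (secondTable w) (z - 1 - firstSize w) a = 0 then 0
  else firstSize w + tableStep w (secondTable w) (z - 1 - firstSize w) a

/-- The transitions of the product in terms of codes. -/
def TableEdge (w : List Bool) (u v : ℕ) : Prop :=
  ∃ p < firstSize w, ∃ p' < secondSize w, ∃ z < firstSize w + secondSize w + 1,
    u = productCode w p p' z ∧ ∃ a < nthNat w 0, 0 < tableStep w 1 p a ∧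
      0 < tableStep w (secondTable w) p' a ∧
      v = productCode w (tableStep w 1 p a - 1) (tableStep w (secondTable w) p' a - 1)
        (tokenTable w z a)

/-- Reachability by at least one transition of the product in terms of codes. -/
def TableReach (w : List Bool) (u v : ℕ) : Prop :=
  Relation.TransGen (fun a b => TableEdge w a b ∧
    b < firstSize w * (secondSize w * (firstSize w + secondSize w + 1))) u v

/-- Witnesses for non-inclusion in terms of codes. -/
def TableWitness (w : List Bool) (p p' : ℕ) : Prop :=
  Even (tableLayer w 1 p) ∧ ¬ Even (tableLayer w (secondTable w) p') ∧
  -- `TableReach` needs at least one edge, so the empty path is a separate case.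
  (productCode w (nthNat w 3) (nthNat w (secondTable w + 2)) 0 =
      productCode w (tableRoot w 1 p) (tableRoot w (secondTable w) p') 0 ∨
    TableReach w (productCode w (nthNat w 3) (nthNat w (secondTable w + 2)) 0)
      (productCode w (tableRoot w 1 p) (tableRoot w (secondTable w) p') 0)) ∧
  TableReach w (productCode w p p' 0) (productCode w p p' 0) ∧
  (∀ c < firstSize w, tableParent w 1 c = p + 1 →
    TableReach w (productCode w p p' (c + 1)) (productCode w p p' 0)) ∧
  ∀ c < secondSize w, tableParent w (secondTable w) c = p' + 1 →
    TableReach w (productCode w p p' (firstSize w + 1 + c)) (productCode w p p' 0)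

/-- Inclusion in terms of the tables. -/
def TableInclusion (w : List Bool) : Prop :=
  ¬ ∃ p < firstSize w, ∃ p' < secondSize w, TableWitness w p p'

/-- Unary entries are no larger than the input, which keeps iterated table lookups polynomially
bounded. -/
theorem nthNat_le_length (w : List Bool) (j : ℕ) : nthNat w j ≤ w.length :=
  (headNat_le_length _).trans (length_iterate_dropNat_le w j)

/-! ### Polynomial time bounds for the table predicates -/

namespace PolyTime

variable {W : (ℕ → List Bool) → List Bool} {b q a u v p p' z : (ℕ → List Bool) → ℕ}

theorem tableStep (hW : PolyTime W) (hb : PolyTimeNat b) (hq : PolyTimeNat q)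
    (ha : PolyTimeNat a) : PolyTimeNat fun e => tableStep (W e) (b e) (q e) (a e) :=
  hW.nthNat ((((hb.add (.const 3)).add (hq.mul ((hW.nthNat (.const 0)).add (.const 2)))).add
    (.const 2)).add ha)

theorem tableParent (hW : PolyTime W) (hb : PolyTimeNat b) (hq : PolyTimeNat q) :
    PolyTimeNat fun e => tableParent (W e) (b e) (q e) :=
  hW.nthNat (((hb.add (.const 3)).add (hq.mul ((hW.nthNat (.const 0)).add (.const 2)))).add
    (.const 1))

theorem tableLayer (hW : PolyTime W) (hb : PolyTimeNat b) (hq : PolyTimeNat q) :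
    PolyTimeNat fun e => tableLayer (W e) (b e) (q e) :=
  hW.nthNat ((hb.add (.const 3)).add (hq.mul ((hW.nthNat (.const 0)).add (.const 2))))

theorem tableRoot (hW : PolyTime W) (hb : PolyTimeNat b) (hq : PolyTimeNat q) :
    PolyTimeNat fun e => tableRoot (W e) (b e) (q e) := by
  refine ((hW.tableLayer hb hq).sub (.const 1)).iterate hq
    (((hW.shift (· + 2)).tableParent (hb.shift (· + 2)) (.var 1)).sub (.const 1))
    (fun e t => List.replicate ((fun x => _root_.tableParent (W e) (b e) x - 1)^[t] (q e)) true)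
    (fun _ => rfl) (fun e t => ?_) ?_
  · simp only [Function.iterate_succ_apply', scons, List.length_replicate]
    rfl
  · obtain ⟨J, P, hP, -⟩ := hW
    obtain ⟨R, hR⟩ := hq.bound
    refine ⟨P + R, fun e B he t ht => ?_⟩
    rw [List.length_replicate, Polynomial.eval_add]
    cases t with
    | zero => exact (hR e B he).trans (Nat.le_add_left _ _)
    | succ t =>
      rw [Function.iterate_succ_apply']
      exact (Nat.sub_le _ _).trans <| (nthNat_le_length _ _).trans <|
        (hP e B he).trans (Nat.le_add_right _ _)

theorem firstSize (hW : PolyTime W) : PolyTimeNat fun e => firstSize (W e) :=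
  hW.nthNat (.const 1)

theorem secondTable (hW : PolyTime W) : PolyTimeNat fun e => secondTable (W e) :=
  (PolyTimeNat.const 4).add
    ((hW.nthNat (.const 1)).mul ((hW.nthNat (.const 0)).add (.const 2)))

theorem secondSize (hW : PolyTime W) : PolyTimeNat fun e => secondSize (W e) :=
  hW.nthNat hW.secondTable

theorem productCode (hW : PolyTime W) (hp : PolyTimeNat p) (hp' : PolyTimeNat p')
    (hz : PolyTimeNat z) : PolyTimeNat fun e => productCode (W e) (p e) (p' e) (z e) :=
  hp.add (hW.firstSize.mul (hp'.add (hW.secondSize.mul hz)))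

theorem tokenTable (hW : PolyTime W) (hz : PolyTimeNat z) (ha : PolyTimeNat a) :
    PolyTimeNat fun e => tokenTable (W e) (z e) (a e) := by
  have h := hW.tableStep hW.secondTable ((hz.sub (.const 1)).sub hW.firstSize) ha
  exact (hz.eq (.const 0)).natIte (.const 0)
    ((hz.lt (hW.firstSize.add (.const 1))).natIte
      (hW.tableStep (.const 1) (hz.sub (.const 1)) ha)
      ((h.eq (.const 0)).natIte (.const 0) (hW.firstSize.add h)))

theorem tableEdge (hW : PolyTime W) (hu : PolyTimeNat u) (hv : PolyTimeNat v) :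
    PolyTimePred fun e => TableEdge (W e) (u e) (v e) := by
  -- Under the four quantifiers the variables `3`, `2`, `1`, `0` are the two states, the token and
  -- the letter.
  have hW4 := hW.shift (· + 4)
  have h1 := hW4.tableStep (.const 1) (.var 3) (.var 0)
  have h2 := hW4.tableStep hW4.secondTable (.var 2) (.var 0)
  exact hW.firstSize.exists_lt <| (hW.shift (· + 1)).secondSize.exists_lt <|
    (((hW.shift (· + 2)).firstSize.add (hW.shift (· + 2)).secondSize).add (.const 1)).exists_lt <|
    ((hu.shift (· + 3)).eq ((hW.shift (· + 3)).productCode (.var 2) (.var 1) (.var 0))).and <|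
    ((hW.shift (· + 3)).nthNat (.const 0)).exists_lt <|
    ((PolyTimeNat.const 0).lt h1).and <| ((PolyTimeNat.const 0).lt h2).and <|
    (hv.shift (· + 4)).eq (hW4.productCode (h1.sub (.const 1)) (h2.sub (.const 1))
      (hW4.tokenTable (.var 1) (.var 0)))

theorem tableReach (hW : PolyTime W) (hu : PolyTimeNat u) (hv : PolyTimeNat v) :
    PolyTimePred fun e => TableReach (W e) (u e) (v e) :=
  PolyTimePred.transGen (E := fun a b e => TableEdge (W e) a b)
    (hW.firstSize.mul (hW.secondSize.mul ((hW.firstSize.add hW.secondSize).add (.const 1))))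
    ((hW.shift (· + 2)).tableEdge (.var 0) (.var 1)) hu hv

theorem tableWitness (hW : PolyTime W) (hp : PolyTimeNat p) (hp' : PolyTimeNat p') :
    PolyTimePred fun e => TableWitness (W e) (p e) (p' e) := by
  have hW1 := hW.shift (· + 1)
  have hp1 := hp.shift (· + 1)
  have hp1' := hp'.shift (· + 1)
  have h0 := hW.productCode (hW.nthNat (.const 3))
    (hW.nthNat (hW.secondTable.add (.const 2))) (.const 0)
  have h1 := hW.productCode (hW.tableRoot (.const 1) hp) (hW.tableRoot hW.secondTable hp')
    (.const 0)
  have h2 := hW.productCode hp hp' (.const 0)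
  have h3 := hW1.productCode hp1 hp1' (.const 0)
  exact (hW.tableLayer (.const 1) hp).even.and <|
    (hW.tableLayer hW.secondTable hp').even.not.and <|
    ((h0.eq h1).or (hW.tableReach h0 h1)).and <| (hW.tableReach h2 h2).and <|
    (hW.firstSize.forall_lt <| ((hW1.tableParent (.const 1) (.var 0)).eq hp1.succ).imp <|
      hW1.tableReach (hW1.productCode hp1 hp1' (PolyTimeNat.var 0).succ) h3).and <|
    hW.secondSize.forall_lt <| ((hW1.tableParent hW1.secondTable (.var 0)).eq hp1'.succ).imp <|
      hW1.tableReach (hW1.productCode hp1 hp1' (hW1.firstSize.succ.add (.var 0))) h3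

theorem tableInclusion (hW : PolyTime W) : PolyTimePred fun e => TableInclusion (W e) :=
  (hW.firstSize.exists_lt <| (hW.shift (· + 1)).secondSize.exists_lt <|
    (hW.shift (· + 2)).tableWitness (.var 1) (.var 0)).not

end PolyTime

/-! ### Correctness of the decision procedure on the tables -/

/-- The number by which a possibly undefined state is coded. -/
def optionNat {n : ℕ} : Option (Fin n) → ℕ
  | none => 0
  | some i => i.val + 1

theorem optionCode_eq {n : ℕ} (o : Option (Fin n)) : optionCode o = unaryCode (optionNat o) := by
  cases o <;> rfl

theorem headNat_unaryCode_append (m : ℕ) (w : List Bool) : headNat (unaryCode m ++ w) = m := by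
  induction m with
  | zero => rfl
  | succ m ih => exact congrArg Nat.succ ih

theorem dropNat_unaryCode_append (m : ℕ) (w : List Bool) : dropNat (unaryCode m ++ w) = w := by
  rw [dropNat, headNat_unaryCode_append]
  exact List.drop_left' (by simp [unaryCode])

theorem nthNat_flatMap_unaryCode {L : List ℕ} {j m : ℕ} (h : L[j]? = some m) :
    nthNat (L.flatMap unaryCode) j = m := by
  induction j generalizing L with
  | zero =>
    cases L with
    | nil => cases h
    | cons a L =>
      cases h
      exact headNat_unaryCode_append ..
  | succ j ih =>
    cases L with
    | nil => cases h
    | cons a L =>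
      rw [nthNat, Function.iterate_succ_apply, List.flatMap_cons, dropNat_unaryCode_append]
      exact ih h

theorem getElem?_flatMap_of_length_eq {α β : Type*} {f : α → List β} {m : ℕ}
    (hf : ∀ a, (f a).length = m) (L : List α) (i : ℕ) {j : ℕ} (hj : j < m) :
    (L.flatMap f)[i * m + j]? = L[i]?.bind fun a => (f a)[j]? := by
  induction L generalizing i with
  | nil => simp
  | cons a L ih =>
    rw [List.flatMap_cons]
    cases i with
    | zero => rw [zero_mul, zero_add, List.getElem?_append_left (by rw [hf]; exact hj)]; rfl
    | succ i =>
      rw [List.getElem?_append_right (by rw [hf, add_mul]; omega), hf,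
        show (i + 1) * m + j - m = i * m + j by rw [add_mul]; omega, ih]
      rfl

namespace LayeredAutomaton

variable {n n' k : ℕ}

/-- The row of a state in the table of an automaton. -/
def row (A : LayeredAutomaton (Fin n) (Fin k)) (q : Fin n) : List ℕ :=
  A.layer q :: optionNat (A.parent q) :: (List.finRange k).map fun a => optionNat (A.step q a)

/-- The numbers in the table of an automaton. -/
def table (A : LayeredAutomaton (Fin n) (Fin k)) : List ℕ :=
  n :: A.depth :: A.init.val :: (List.finRange n).flatMap A.row

theorem length_row (A : LayeredAutomaton (Fin n) (Fin k)) (q : Fin n) :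
    (A.row q).length = k + 2 := by
  simp [row]

theorem length_table (A : LayeredAutomaton (Fin n) (Fin k)) :
    A.table.length = 3 + n * (k + 2) := by
  simp [table, length_row, List.length_flatMap]
  omega

theorem code_eq (A : LayeredAutomaton (Fin n) (Fin k)) :
    A.code = A.table.flatMap unaryCode := by
  simp only [code, table, List.flatMap_cons, List.flatMap_assoc, List.append_assoc, row,
    List.flatMap_map, optionCode_eq]

/-- The word `w` contains the table of `A` at position `b`. -/
structure IsTable (w : List Bool) (b : ℕ) (A : LayeredAutomaton (Fin n) (Fin k)) : Prop where
  size : nthNat w b = n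
  init : nthNat w (b + 2) = A.init
  layer : ∀ q : Fin n, tableLayer w b q = A.layer q
  parent : ∀ q : Fin n, tableParent w b q = optionNat (A.parent q)
  step : ∀ (q : Fin n) (a : Fin k), tableStep w b q a = optionNat (A.step q a)

/-- Numbers are self-delimiting and all rows have `k + 2` entries, so the index of an entry does not
depend on the values stored before it. -/
theorem isTable (A : LayeredAutomaton (Fin n) (Fin k)) {L pre post : List ℕ}
    (hL : L = pre ++ (A.table ++ post)) (hk : nthNat (L.flatMap unaryCode) 0 = k) :
    IsTable (L.flatMap unaryCode) pre.length A := by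
  have h1 : ∀ i m, A.table[i]? = some m → nthNat (L.flatMap unaryCode) (pre.length + i) = m := by
    intro i m h
    refine nthNat_flatMap_unaryCode ?_
    obtain ⟨hi, -⟩ := List.getElem?_eq_some_iff.1 h
    rw [hL, List.getElem?_append_right (Nat.le_add_right ..), Nat.add_sub_cancel_left,
      List.getElem?_append_left hi, h]
  have h2 : ∀ (q : Fin n) i m, (A.row q)[i]? = some m →
      nthNat (L.flatMap unaryCode) (pre.length + (q * (k + 2) + i + 3)) = m := by
    intro q i m h
    refine h1 _ _ ?_
    obtain ⟨hi, -⟩ := List.getElem?_eq_some_iff.1 h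
    rw [length_row] at hi
    refine (getElem?_flatMap_of_length_eq A.length_row (List.finRange n) q hi).trans ?_
    simpa using h
  refine ⟨h1 0 _ rfl, h1 2 _ rfl, fun q => ?_, fun q => ?_, fun q a => ?_⟩
  · rw [← h2 q 0 _ rfl, tableLayer, hk]
    congr 1
    omega
  · rw [← h2 q 1 _ rfl, tableParent, hk]
    congr 1
    omega
  · rw [← h2 q (a + 2) (optionNat (A.step q a)) (by simp [row]), tableStep, hk]
    congr 1
    omega

theorem IsTable.root {w : List Bool} {b : ℕ} {A : LayeredAutomaton (Fin n) (Fin k)}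
    (h : IsTable w b A) {q r : Fin n} (hr : A.ancestor 1 q = some r) : tableRoot w b q = r := by
  rw [tableRoot, h.layer]
  induction hm : A.layer q - 1 generalizing q with
  | zero =>
    have h1 : A.layer q = 1 := by have := A.one_le_layer q; omega
    rw [← h1, A.ancestor_self] at hr
    rw [Option.some.inj hr]
    rfl
  | succ m ih =>
    obtain ⟨p, hp⟩ := A.exists_parent (q := q) (by omega)
    have hl := A.layer_parent _ _ hp
    rw [A.ancestor_of_parent hp (A.one_le_layer p)] at hr
    rw [Function.iterate_succ_apply, h.parent, hp]
    exact ih hr (by omega)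

/-- The code of an additional state of the product. -/
def tokenCode : Option (Fin n ⊕ Fin n') → ℕ
  | none => 0
  | some (.inl c) => c + 1
  | some (.inr c) => n + 1 + c

theorem tokenCode_injective : Function.Injective (tokenCode (n := n) (n' := n')) := by
  rintro (_ | c | c) (_ | d | d) h <;> simp only [tokenCode] at h
  · rfl
  · omega
  · omega
  · omega
  · rw [Fin.ext (by omega : c.val = d.val)]
  · omega
  · omega
  · omega
  · rw [Fin.ext (by omega : c.val = d.val)]

theorem tokenCode_lt (z : Option (Fin n ⊕ Fin n')) : tokenCode z < n + n' + 1 := by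
  rcases z with _ | c | c <;> simp only [tokenCode] <;> omega

theorem _root_.add_mul_lt_mul {a b c d : ℕ} (ha : a < b) (hc : c < d) : a + b * c < b * d :=
  calc a + b * c < b + b * c := by omega
    _ = b * (c + 1) := by ring
    _ ≤ b * d := Nat.mul_le_mul_left b hc

theorem _root_.add_mul_inj {a a' b c c' : ℕ} (ha : a < b) (ha' : a' < b)
    (h : a + b * c = a' + b * c') : a = a' ∧ c = c' := by
  have h1 := congrArg (· % b) h
  simp only [Nat.add_mul_mod_self_left, Nat.mod_eq_of_lt ha, Nat.mod_eq_of_lt ha'] at h1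
  subst h1
  exact ⟨rfl, Nat.eq_of_mul_eq_mul_left (by omega) (Nat.add_left_cancel h)⟩

section

variable {w : List Bool} {A : LayeredAutomaton (Fin n) (Fin k)}
  {A' : LayeredAutomaton (Fin n') (Fin k)}

/-- The code of a state of the product. -/
def nodeCode (w : List Bool) (x : Fin n × Fin n' × Option (Fin n ⊕ Fin n')) : ℕ :=
  productCode w x.1 x.2.1 (tokenCode x.2.2)

theorem productCode_inj {p q p' q' z z' : ℕ} (hp : p < firstSize w) (hq : q < firstSize w)
    (hp' : p' < secondSize w) (hq' : q' < secondSize w)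
    (h : productCode w p p' z = productCode w q q' z') : p = q ∧ p' = q' ∧ z = z' := by
  obtain ⟨h1, h2⟩ := add_mul_inj hp hq h
  obtain ⟨h3, h4⟩ := add_mul_inj hp' hq' h2
  exact ⟨h1, h3, h4⟩

variable (hk : nthNat w 0 = k) (hA : IsTable w 1 A) (hA' : IsTable w (secondTable w) A')
include hA hA'

theorem nodeCode_injective :
    Function.Injective (nodeCode w : Fin n × Fin n' × Option (Fin n ⊕ Fin n') → ℕ) := by
  rintro ⟨p, p', z⟩ ⟨q, q', z'⟩ h
  have h1 : firstSize w = n := hA.size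
  have h2 : secondSize w = n' := hA'.size
  obtain ⟨h3, h4, h5⟩ := productCode_inj (by rw [h1]; exact p.2) (by rw [h1]; exact q.2)
    (by rw [h2]; exact p'.2) (by rw [h2]; exact q'.2) h
  exact Prod.ext (Fin.ext h3) (Prod.ext (Fin.ext h4) (tokenCode_injective h5))

theorem nodeCode_lt (x : Fin n × Fin n' × Option (Fin n ⊕ Fin n')) :
    nodeCode w x < firstSize w * (secondSize w * (firstSize w + secondSize w + 1)) := by
  have h1 : firstSize w = n := hA.size
  have h2 : secondSize w = n' := hA'.size
  refine add_mul_lt_mul (by rw [h1]; exact x.1.2) (add_mul_lt_mul (by rw [h2]; exact x.2.1.2) ?_)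
  rw [h1, h2]
  exact tokenCode_lt _

theorem tokenTable_eq (z : Option (Fin n ⊕ Fin n')) (a : Fin k) :
    tokenTable w (tokenCode z) a = tokenCode (tokenStep A A' a z) := by
  have h1 : firstSize w = n := hA.size
  rcases z with _ | c | c
  · rfl
  · rw [tokenTable, h1, tokenCode, if_neg (by omega), if_pos (by omega), Nat.add_sub_cancel,
      hA.step, tokenStep]
    cases A.step c a <;> rfl
  · rw [tokenTable, h1, tokenCode, if_neg (by omega), if_neg (by omega),
      show n + 1 + c.val - 1 - n = c by omega, hA'.step, tokenStep]
    cases A'.step c a with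
    | none => rfl
    | some d =>
      exact (if_neg (Nat.succ_ne_zero d.val)).trans
        (show n + (d.val + 1) = n + 1 + d.val by omega)

include hk

/-- The target `v` is an arbitrary number: edges leaving a code end in a code, so paths from codes
never leave the encoded product. -/
theorem tableEdge_nodeCode_iff (x : Fin n × Fin n' × Option (Fin n ⊕ Fin n')) (v : ℕ) :
    TableEdge w (nodeCode w x) v ↔ ∃ y, v = nodeCode w y ∧ ProductEdge A A' x y := by
  have h1 : firstSize w = n := hA.size
  have h2 : secondSize w = n' := hA'.size
  obtain ⟨p, p', z⟩ := x
  have hz := tokenCode_lt z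
  constructor
  · rintro ⟨q, hq, q', hq', z', -, hx, a, ha, hs, hs', rfl⟩
    obtain ⟨rfl, rfl, rfl⟩ := productCode_inj (by rw [h1]; exact p.2) hq
      (by rw [h2]; exact p'.2) hq' hx
    rw [hk] at ha
    have e1 := hA.step p ⟨a, ha⟩
    have e2 := hA'.step p' ⟨a, ha⟩
    have e3 := tokenTable_eq hA hA' z ⟨a, ha⟩
    simp only at e1 e2 e3
    rw [e1] at hs ⊢
    rw [e2] at hs' ⊢
    rw [e3]
    cases f1 : A.step p ⟨a, ha⟩ with
    | none => simp [f1, optionNat] at hs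
    | some r =>
      cases f2 : A'.step p' ⟨a, ha⟩ with
      | none => simp [f2, optionNat] at hs'
      | some r' => exact ⟨(r, r', _), rfl, ⟨a, ha⟩, f1, f2, rfl⟩
  · rintro ⟨⟨r, r', z'⟩, rfl, a, f1, f2, rfl⟩
    simp only at f1 f2
    refine ⟨p, by rw [h1]; exact p.2, p', by rw [h2]; exact p'.2, tokenCode z,
      by rw [h1, h2]; exact hz, rfl, a, by rw [hk]; exact a.2, ?_, ?_, ?_⟩
    · rw [hA.step, f1]
      exact Nat.succ_pos _
    · rw [hA'.step, f2]
      exact Nat.succ_pos _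
    · rw [hA.step, f1, hA'.step, f2, tokenTable_eq hA hA']
      rfl

theorem tableReach_nodeCode_iff (x y : Fin n × Fin n' × Option (Fin n ⊕ Fin n')) :
    TableReach w (nodeCode w x) (nodeCode w y) ↔ Relation.TransGen (ProductEdge A A') x y := by
  constructor
  · have key : ∀ v, TableReach w (nodeCode w x) v →
        ∃ y, v = nodeCode w y ∧ Relation.TransGen (ProductEdge A A') x y := by
      intro v h
      induction h with
      | single h =>
        obtain ⟨y, hy, h⟩ := (tableEdge_nodeCode_iff hk hA hA' x _).1 h.1
        exact ⟨y, hy, .single h⟩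
      | tail _ h ih =>
        obtain ⟨y, rfl, hxy⟩ := ih
        obtain ⟨z, hz, h⟩ := (tableEdge_nodeCode_iff hk hA hA' y _).1 h.1
        exact ⟨z, hz, hxy.tail h⟩
    intro h
    obtain ⟨z, hz, h⟩ := key _ h
    rwa [nodeCode_injective hA hA' hz]
  · intro h
    refine Relation.TransGen.lift (nodeCode w) (fun a b hab => ⟨?_, ?_⟩) _ _ h
    · exact (tableEdge_nodeCode_iff hk hA hA' a _).2 ⟨b, rfl, hab⟩
    · exact nodeCode_lt hA hA' b

theorem tableWitness_iff (p : Fin n) (p' : Fin n') :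
    TableWitness w p p' ↔ NonInclusionWitness A A' p p' := by
  obtain ⟨r, hr, -⟩ := A.exists_ancestor_one p
  obtain ⟨r', hr', -⟩ := A'.exists_ancestor_one p'
  have reach := tableReach_nodeCode_iff hk hA hA'
  have h1 : firstSize w = n := hA.size
  have h2 : secondSize w = n' := hA'.size
  have e0 : productCode w (nthNat w 3) (nthNat w (secondTable w + 2)) 0 =
      nodeCode w (A.init, A'.init, none) := by
    rw [hA.init, hA'.init]
    rfl
  have e1 : productCode w (tableRoot w 1 p) (tableRoot w (secondTable w) p') 0 =
      nodeCode w (r, r', none) := by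
    rw [hA.root hr, hA'.root hr']
    rfl
  have e2 : productCode w p p' 0 = nodeCode w (p, p', none) := rfl
  have e3 : ∀ c : Fin n, productCode w p p' (c + 1) = nodeCode w (p, p', some (.inl c)) :=
    fun _ => rfl
  have e4 : ∀ c : Fin n', productCode w p p' (firstSize w + 1 + c) =
      nodeCode w (p, p', some (.inr c)) := fun c => by
    rw [h1]
    rfl
  have par : ∀ (o : Option (Fin n)), optionNat o = p + 1 ↔ o = some p := by
    rintro (_ | o)
    · simp [optionNat]
    · simp [optionNat, Fin.ext_iff]
  have par' : ∀ (o : Option (Fin n')), optionNat o = p' + 1 ↔ o = some p' := by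
    rintro (_ | o)
    · simp [optionNat]
    · simp [optionNat, Fin.ext_iff]
  rw [TableWitness, NonInclusionWitness, hA.layer, hA'.layer, Nat.not_even_iff_odd, e0, e1, e2,
    reach, reach, (nodeCode_injective hA hA').eq_iff]
  refine and_congr_right fun _ => and_congr_right fun _ => and_congr ?_
    (and_congr_right fun _ => and_congr ?_ ?_)
  · rw [eq_comm, ← Relation.reflTransGen_iff_eq_or_transGen]
    constructor
    · exact fun h => ⟨r, r', hr, hr', h⟩
    · rintro ⟨s, s', hs, hs', h⟩
      rw [hr] at hs
      rw [hr'] at hs'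
      cases hs
      cases hs'
      exact h
  · constructor
    · intro h c hc
      have := h c (by rw [h1]; exact c.2) (by rw [hA.parent, par, hc])
      rwa [e3, reach] at this
    · intro h c hc hpc
      rw [h1] at hc
      lift c to Fin n using hc
      rw [hA.parent, par] at hpc
      rw [e3, reach]
      exact h c hpc
  · constructor
    · intro h c hc
      have := h c (by rw [h2]; exact c.2) (by rw [hA'.parent, par', hc])
      rwa [e4, reach] at this
    · intro h c hc hpc
      rw [h2] at hc
      lift c to Fin n' using hc
      rw [hA'.parent, par'] at hpc
      rw [e4, reach]
      exact h c hpc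

theorem tableInclusion_iff :
    TableInclusion w ↔ ¬ ∃ p p', NonInclusionWitness A A' p p' := by
  have h1 : firstSize w = n := hA.size
  have h2 : secondSize w = n' := hA'.size
  refine not_congr ⟨?_, ?_⟩
  · rintro ⟨p, hp, p', hp', h⟩
    rw [h1] at hp
    rw [h2] at hp'
    exact ⟨⟨p, hp⟩, ⟨p', hp'⟩, (tableWitness_iff hk hA hA' ⟨p, hp⟩ ⟨p', hp'⟩).1 h⟩
  · rintro ⟨p, p', h⟩
    exact ⟨p, by rw [h1]; exact p.2, p', by rw [h2]; exact p'.2,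
      (tableWitness_iff hk hA hA' p p').2 h⟩

end

end LayeredAutomaton

open LayeredAutomaton in
theorem InclusionInstance.tableInclusion_iff (I : InclusionInstance) (q : I.A.InitialLeaf)
    (q' : I.A'.InitialLeaf) :
    TableInclusion I.code ↔ (I.A.sem q).language ⊆ (I.A'.sem q').language := by
  set L : List ℕ := I.k :: (I.A.table ++ I.A'.table) with hL
  have hcode : I.code = L.flatMap unaryCode := by
    simp only [InclusionInstance.code, code_eq, hL, List.flatMap_cons, List.flatMap_append,
      List.append_assoc]
  have hk : nthNat (L.flatMap unaryCode) 0 = I.k := nthNat_flatMap_unaryCode rfl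
  have hA := I.A.isTable (L := L) (pre := [I.k]) (post := I.A'.table) rfl hk
  have hA' := I.A'.isTable (L := L) (pre := I.k :: I.A.table) (post := []) (by simp [hL]) hk
  have hb : (I.k :: I.A.table).length = secondTable (L.flatMap unaryCode) := by
    have h1 : nthNat (L.flatMap unaryCode) 1 = I.n := hA.size
    rw [List.length_cons, length_table, secondTable, hk, h1]
    omega
  rw [hb] at hA'
  rw [language_subset_iff I.consistent I.consistent', hcode]
  exact LayeredAutomaton.tableInclusion_iff hk hA hA'

theorem mainTheorem9 :
    ∃ f : InclusionInstance → Bool,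
      Nonempty (Turing.TM2ComputableInPolyTime InclusionInstance.code Computability.encodeBool f) ∧
      ∀ (I : InclusionInstance) (q : I.A.InitialLeaf) (q' : I.A'.InitialLeaf),
        f I = true ↔ (I.A.sem q).language ⊆ (I.A'.sem q').language := by
  classical
  -- The answer is a function of the code alone, hence independent of the initial leaves.
  refine ⟨fun I => decide (TableInclusion I.code), ?_, fun I q q' => ?_⟩
  · have h := (PolyTime.tableInclusion (PolyTime.var 0)).ite (PolyTime.nil.cons true)
      (PolyTime.nil.cons false)
    refine h.nonempty_tm2ComputableInPolyTime fun I => ?_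
    by_cases hI : TableInclusion I.code <;> simp [hI]
  · rw [decide_eq_true_iff, I.tableInclusion_iff q q']
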